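/- **Definitions.** A *ribbon graph* with $n$ faces is given by a finite non-empty set $X$ (oriented edges) with a permutation $s_0$ all of whose cycles have length at least $3$, a fixed-point-free involution $s_1$, such that $\langle s_0,s_1\rangle$ acts transitively on $X$, and a labelling by $n$ labels of the cycles of $s_2=s_1s_0^{-1}$. The vertices, edges and faces are the cycles of $s_0$, $s_1$ and $s_2$; here $s_0$ rotates anticlockwise the oriented edges pointing toward a vertex, $s_1$ reverses oriented edges, and $s_2x$ is the edge following $x$ along the face to its left. A *metric ribbon graph* $\widetilde\Gamma$ is a ribbon graph with a positive length $\ell_e$ for each edge $e$; it is regarded as a compact metric space with its path metric. For $N>0$, $N\widetilde\Gamma$ has the edge lengths $N\ell_e$. For $\lambda>0$ and a metric space $Y$, $\lambda Y$ is $Y$ with its metric multiplied by $\lambda$. Let positive numbers $\rho_v$ be assigned to the vertices $v$ of $\widetilde\Gamma$. For each oriented edge $x$ from $u$ to $v$, let $Q_x$ be the hyperbolic quadrilateral with a base of length $\ell_x$, two right angles at the ends of the base, and sides (*ribs*) of length $\rho_u$ and $\rho_v$ perpendicular to the base at its tail and head end; $Q_x$ lies to the left of $x$, with the fourth side playing the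 role of the edge $x$. Call $(\rho_v)$ a *system of rib lengths* if, at every vertex $v$, the angles of the corners of these quadrilaterals lying at $v$ add up to $2\pi$. For a system of rib lengths, gluing isometrically the fourth sides of $Q_x$ and $Q_{s_1x}$ (reversing direction) and the head rib of $Q_x$ to the tail rib of $Q_{s_2x}$, for all $x$, gives the compact hyperbolic surface with geodesic boundary $S(\widetilde\Gamma)$ with spine $\widetilde\Gamma$, endowed with its path metric; $Q_x$ and $Q_{s_1x}$ together form the hexagon with four right angles around the edge $x$ into which $S(\widetilde\Gamma)$ is cut by the ribs. This is the inverse Bowditch–Epstein construction. **Theorem 5.6.** For every metric ribbon graph $\widetilde\Gamma$ and every real $N>0$, $N\widetilde\Gamma$ has exactly one system of rib lengths (so that $S(N\widetilde\Gamma)$ is well defined), and $$\lim_{N\to\infty}\tfrac1N\,S(N\widetilde\Gamma)=\widetilde\Gamma$$ in the Gromov–Hausdorff topology. -/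

import Mathlib

open scoped ENNReal UpperHalfPlane
open Filter Topology

noncomputable section

/-! ## Ribbon graphs -/

/-- A (connected, labelled) ribbon graph with `n` faces whose set of oriented edges is `X`.
The permutation `s₀` rotates the oriented edges pointing toward a common vertex anticlockwise, and
`s₁` reverses oriented edges.  All cycles of `s₀` have length at least three (every vertex has degree
at least three) and `s₁` is an involution without fixed points.  Since a ribbon graph is
the `1`-skeleton of a cell decomposition of a connected surface, `s₀` and `s₁` together act
transitively. The faces, i.e. the cycles of `s₂ = s₁ s₀⁻¹`, are labelled by `n` labels. -/
structure RibbonGraph (X : Type*) (n : ℕ) where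
  s₀ : Equiv.Perm X
  s₁ : Equiv.Perm X
  s₀_ne : ∀ x, s₀ x ≠ x
  s₀_s₀_ne : ∀ x, s₀ (s₀ x) ≠ x
  s₁_s₁ : ∀ x, s₁ (s₁ x) = x
  s₁_ne : ∀ x, s₁ x ≠ x
  connected : ∀ x y, ∃ g ∈ Subgroup.closure {s₀, s₁}, g x = y
  label : Quotient (Equiv.Perm.SameCycle.setoid (s₁ * s₀⁻¹)) ≃ Fin n

namespace RibbonGraph

variable {X : Type*} {n : ℕ}

/-- Vertices are the cycles of `s₀`. -/
def Vertex (G : RibbonGraph X n) : Type _ := Quotient (Equiv.Perm.SameCycle.setoid G.s₀)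

/-- Unoriented edges are the cycles of `s₁`. -/
def Edge (G : RibbonGraph X n) : Type _ := Quotient (Equiv.Perm.SameCycle.setoid G.s₁)

/-- `s₂ x` is the oriented edge that follows `x` along the face on the left of `x`. -/
def s₂ (G : RibbonGraph X n) : Equiv.Perm X := G.s₁ * G.s₀⁻¹

/-- The vertex toward which the oriented edge `x` points. -/
def head (G : RibbonGraph X n) (x : X) : G.Vertex :=
  Quotient.mk (Equiv.Perm.SameCycle.setoid G.s₀) x

/-- The vertex from which the oriented edge `x` emanates. -/
def tail (G : RibbonGraph X n) (x : X) : G.Vertex := G.head (G.s₁ x)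

/-- The unoriented edge underlying the oriented edge `x`. -/
def edge (G : RibbonGraph X n) (x : X) : G.Edge :=
  Quotient.mk (Equiv.Perm.SameCycle.setoid G.s₁) x

theorem head_s₀ (G : RibbonGraph X n) (x : X) : G.head (G.s₀ x) = G.head x :=
  Quotient.sound (s := Equiv.Perm.SameCycle.setoid G.s₀)
    (Equiv.Perm.sameCycle_apply_left.2 (Equiv.Perm.SameCycle.refl _ _))

theorem tail_s₁ (G : RibbonGraph X n) (x : X) : G.tail (G.s₁ x) = G.head x := by
  rw [tail, G.s₁_s₁]

/-- An equivalence relation that is compatible with `s₀` and `s₁` has a single class. -/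
theorem rel_of_connected (G : RibbonGraph X n) {r : X → X → Prop} (hr : Equivalence r)
    (h0 : ∀ x, r x (G.s₀ x)) (h1 : ∀ x, r x (G.s₁ x)) (x y : X) : r x y := by
  obtain ⟨g, hg, hy⟩ := G.connected x y
  rw [← hy]
  clear hy y
  revert x
  induction hg using Subgroup.closure_induction with
  | mem g hg =>
    rcases hg with rfl | rfl
    · exact h0
    · exact h1
  | one => exact fun x => hr.refl x
  | mul a b _ _ ha hb => exact fun x => hr.trans (hb x) (ha (b x))
  | inv a _ ha =>
    intro x
    have := ha (a⁻¹ x)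
    have hx : a (a⁻¹ x) = x := Equiv.apply_symm_apply a x
    rw [hx] at this
    exact hr.symm this

end RibbonGraph

/-- A metric ribbon graph: a ribbon graph with a positive real number assigned to each edge. -/
structure MetricRibbonGraph (X : Type*) (n : ℕ) extends RibbonGraph X n where
  edgeLength : toRibbonGraph.Edge → ℝ
  edgeLength_pos : ∀ e, 0 < edgeLength e

/-- Positive real numbers (scale factors). -/
abbrev PosReal : Type := {c : ℝ // 0 < c}

namespace MetricRibbonGraph

variable {X : Type*} {n : ℕ}

/-- The length of the edge underlying an oriented edge. -/
def len (G : MetricRibbonGraph X n) (x : X) : ℝ := G.edgeLength (G.edge x)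

theorem len_pos (G : MetricRibbonGraph X n) (x : X) : 0 < G.len x := G.edgeLength_pos _

theorem len_s₁ (G : MetricRibbonGraph X n) (x : X) : G.len (G.s₁ x) = G.len x := by
  have : G.edge (G.s₁ x) = G.edge x :=
    Quotient.sound (s := Equiv.Perm.SameCycle.setoid G.s₁)
      (Equiv.Perm.sameCycle_apply_left.2 (Equiv.Perm.SameCycle.refl _ _))
  rw [len, this, len]

/-- The metric ribbon graph `N Γ`, all of whose edges are `N` times as long as those of `Γ`. -/
def scale (N : PosReal) (G : MetricRibbonGraph X n) : MetricRibbonGraph X n where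
  toRibbonGraph := G.toRibbonGraph
  edgeLength e := N * G.edgeLength e
  edgeLength_pos e := mul_pos N.2 (G.edgeLength_pos e)

end MetricRibbonGraph

/-! ## Gluing metric spaces -/

/-- Instructions for gluing: a family of subsets `piece i` of a metric space `Y`, and a relation
saying which points of the disjoint union of the pieces are identified: `glue i y j z` says that the
point `y` of `piece i` is identified with the point `z` of `piece j`. -/
structure GluingData (ι Y : Type*) where
  piece : ι → Set Y
  glue : ι → Y → ι → Y → Prop

namespace GluingData

variable {ι Y : Type*}

/-- The disjoint union of the pieces. -/
structure Point (D : GluingData ι Y) where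
  idx : ι
  pt : Y
  mem : pt ∈ D.piece idx

variable [PseudoEMetricSpace Y] (D : GluingData ι Y)

open Classical in
/-- The cost of a single step in the disjoint union of the pieces: moving between glued
points is free, moving within a piece costs the distance, and other steps are not allowed. -/
def step (p q : D.Point) : ℝ≥0∞ :=
  if D.glue p.idx p.pt q.idx q.pt ∨ D.glue q.idx q.pt p.idx p.pt then 0
  else if p.idx = q.idx then edist p.pt q.pt else ⊤

/-- The total cost of the chain of steps from `p` to `q` through the points of a list. -/
def chainLength : D.Point → List D.Point → D.Point → ℝ≥0∞
  | p, [], q => D.step p q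
  | p, a :: l, q => D.step p a + chainLength a l q

theorem step_self (p : D.Point) : D.step p p = 0 := by
  unfold step; split_ifs <;> simp_all

theorem step_comm (p q : D.Point) : D.step p q = D.step q p := by
  unfold step
  rw [edist_comm p.pt q.pt]
  congr 1
  · exact propext or_comm
  · congr 1
    exact propext eq_comm

theorem chainLength_append (p : D.Point) (l : List D.Point) (q : D.Point) (m : List D.Point)
    (r : D.Point) :
    D.chainLength p (l ++ q :: m) r = D.chainLength p l q + D.chainLength q m r := by
  induction l generalizing p with
  | nil => rfl
  | cons a l ih => simp only [List.cons_append, chainLength, ih, add_assoc]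

theorem chainLength_reverse (p : D.Point) (l : List D.Point) (q : D.Point) :
    D.chainLength q l.reverse p = D.chainLength p l q := by
  induction l generalizing p with
  | nil => exact D.step_comm _ _
  | cons a l ih =>
    rw [List.reverse_cons, chainLength_append, ih]
    simp only [chainLength]
    rw [add_comm, D.step_comm]

/-- The gluing (quotient) pseudo-distance: the infimum of the costs of all chains. -/
instance : PseudoEMetricSpace D.Point where
  edist p q := ⨅ l : List D.Point, D.chainLength p l q
  edist_self p := le_antisymm (iInf_le_of_le [] (D.step_self p).le) zero_le
  edist_comm p q := by
    apply le_antisymm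
    · exact le_iInf fun l => iInf_le_of_le l.reverse (D.chainLength_reverse q l p).le
    · exact le_iInf fun l => iInf_le_of_le l.reverse (D.chainLength_reverse p l q).le
  edist_triangle p q r := by
    change _ ≤ (⨅ l : List D.Point, D.chainLength p l q) + ⨅ m : List D.Point, D.chainLength q m r
    rw [ENNReal.iInf_add]
    refine le_iInf fun l => ?_
    rw [ENNReal.add_iInf]
    exact le_iInf fun m => iInf_le_of_le (l ++ q :: m) (D.chainLength_append p l q m r).le

/-- The glued space: points of the disjoint union at distance zero are identified. -/
def Space : Type _ := SeparationQuotient D.Point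

instance : EMetricSpace D.Space := inferInstanceAs (EMetricSpace (SeparationQuotient D.Point))

theorem edist_le_step (p q : D.Point) : edist p q ≤ D.step p q := iInf_le_of_le [] le_rfl

theorem edist_le_of_piece {i : ι} {y z : Y} (hy : y ∈ D.piece i) (hz : z ∈ D.piece i) :
    edist (⟨i, y, hy⟩ : D.Point) ⟨i, z, hz⟩ ≤ edist y z := by
  refine (D.edist_le_step _ _).trans ?_
  unfold step
  split_ifs <;> simp_all

theorem edist_eq_zero_of_glue {p q : D.Point} (h : D.glue p.idx p.pt q.idx q.pt) : edist p q = 0 := by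
  refine le_antisymm ((D.edist_le_step _ _).trans ?_) zero_le
  simp [step, h]

theorem compactSpace [Finite ι] (h : ∀ i, IsCompact (D.piece i)) : CompactSpace D.Space := by
  have hmk : Continuous (SeparationQuotient.mk : D.Point → SeparationQuotient D.Point) :=
    SeparationQuotient.continuous_mk
  let f : (i : ι) → D.piece i → SeparationQuotient D.Point :=
    fun i y => SeparationQuotient.mk (⟨i, y.1, y.2⟩ : D.Point)
  have hf : ∀ i, Continuous (f i) := by
    intro i
    refine hmk.comp ?_
    have : LipschitzWith 1 (fun y : D.piece i => (⟨i, y.1, y.2⟩ : D.Point)) := by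
      intro y z
      rw [ENNReal.coe_one, one_mul]
      exact D.edist_le_of_piece y.2 z.2
    exact this.continuous
  have huniv : (⋃ i, Set.range (f i)) = Set.univ := by
    refine Set.eq_univ_of_forall fun q => ?_
    obtain ⟨⟨i, y, hy⟩, rfl⟩ := SeparationQuotient.surjective_mk q
    exact Set.mem_iUnion.2 ⟨i, ⟨⟨y, hy⟩, rfl⟩⟩
  have : CompactSpace (SeparationQuotient D.Point) := by
    refine ⟨?_⟩
    rw [← huniv]
    refine isCompact_iUnion fun i => ?_
    have : CompactSpace (D.piece i) := isCompact_iff_compactSpace.1 (h i)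
    exact isCompact_range (hf i)
  exact this

end GluingData

/-! ## Rescaling a metric space -/

/-- `Rescaled c X` is the metric space `c X`, that is `X` with its metric multiplied by `c`. -/
structure Rescaled (c : PosReal) (X : Type*) where
  of ::
  val : X

namespace Rescaled

variable {c : PosReal} {X : Type*}

instance [MetricSpace X] : MetricSpace (Rescaled c X) where
  dist p q := c * dist p.val q.val
  dist_self p := by simp
  dist_comm p q := by rw [dist_comm]
  dist_triangle p q r := by
    rw [← mul_add]
    exact mul_le_mul_of_nonneg_left (dist_triangle _ _ _) c.2.le
  eq_of_dist_eq_zero {p q} h := by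
    have : p.val = q.val := dist_eq_zero.1 ((mul_eq_zero.1 h).resolve_left c.2.ne')
    cases p; cases q; simp_all

instance [Nonempty X] : Nonempty (Rescaled c X) := ⟨⟨Classical.arbitrary X⟩⟩

instance [MetricSpace X] [CompactSpace X] : CompactSpace (Rescaled c X) := by
  have hf : LipschitzWith ⟨c, c.2.le⟩ (Rescaled.of : X → Rescaled c X) :=
    LipschitzWith.of_dist_le_mul fun _ _ => le_rfl
  have hs : Function.Surjective (Rescaled.of : X → Rescaled c X) := fun p => ⟨p.val, rfl⟩
  exact hs.compactSpace hf.continuous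

end Rescaled

/-! ## The metric graph -/

namespace MetricRibbonGraph

variable {X : Type*} {n : ℕ}

/-- The metric graph is glued from one interval `[0, len x]` for each oriented edge `x`,
parametrised from the tail of `x` to its head: the intervals of `x` and of its reverse are
identified, and end points at the same vertex are identified. -/
def graphGluing (G : MetricRibbonGraph X n) : GluingData X ℝ where
  piece x := Set.Icc 0 (G.len x)
  glue x a y b := (y = G.s₁ x ∧ a + b = G.len x) ∨
    (G.head x = G.head y ∧ a = G.len x ∧ b = G.len y)

/-- The metric graph underlying a metric ribbon graph, with its path metric. -/
def Graph (G : MetricRibbonGraph X n) : Type _ := G.graphGluing.Space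

theorem graph_edist_ne_top (G : MetricRibbonGraph X n) (p q : G.Graph) :
    @edist _ (inferInstanceAs (EDist G.graphGluing.Space)) p q ≠ ⊤ := by
  let e : X → G.graphGluing.Point := fun x => ⟨x, G.len x, ⟨(G.len_pos x).le, le_rfl⟩⟩
  have key : ∀ x y, edist (e x) (e y) < ⊤ := by
    refine G.rel_of_connected (r := fun x y => edist (e x) (e y) < ⊤) ?_ ?_ ?_
    · refine ⟨fun x => by simp, fun {x y} h => by rwa [edist_comm], fun {x y z} h h' => ?_⟩
      exact (edist_triangle _ (e y) _).trans_lt (ENNReal.add_lt_top.2 ⟨h, h'⟩)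
    · intro x
      rw [G.graphGluing.edist_eq_zero_of_glue (Or.inr ⟨(G.head_s₀ x).symm, rfl, rfl⟩)]
      exact ENNReal.zero_lt_top
    · intro x
      have h0 : (0 : ℝ) ∈ G.graphGluing.piece (G.s₁ x) := ⟨le_rfl, (G.len_pos _).le⟩
      refine (edist_triangle _ (⟨G.s₁ x, 0, h0⟩ : G.graphGluing.Point) _).trans_lt ?_
      refine ENNReal.add_lt_top.2 ⟨?_, ?_⟩
      · rw [G.graphGluing.edist_eq_zero_of_glue (Or.inl ⟨rfl, by simp [e]⟩)]
        exact ENNReal.zero_lt_top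
      · exact (G.graphGluing.edist_le_of_piece _ _).trans_lt (edist_lt_top _ _)
  have toe : ∀ p : G.graphGluing.Point, edist p (e p.idx) < ⊤ := fun p =>
    (G.graphGluing.edist_le_of_piece p.mem _).trans_lt (edist_lt_top _ _)
  obtain ⟨p, rfl⟩ := SeparationQuotient.surjective_mk p
  obtain ⟨q, rfl⟩ := SeparationQuotient.surjective_mk q
  refine ne_of_lt (b := ⊤) (?_ : edist p q < ⊤)
  refine (edist_triangle _ (e p.idx) _).trans_lt (ENNReal.add_lt_top.2 ⟨toe p, ?_⟩)
  refine (edist_triangle _ (e q.idx) _).trans_lt (ENNReal.add_lt_top.2 ⟨key _ _, ?_⟩)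
  rw [edist_comm]
  exact toe q

instance (G : MetricRibbonGraph X n) : MetricSpace G.Graph :=
  @EMetricSpace.toMetricSpace _ (inferInstanceAs (EMetricSpace G.graphGluing.Space))
    G.graph_edist_ne_top

instance [Finite X] (G : MetricRibbonGraph X n) : CompactSpace G.Graph :=
  G.graphGluing.compactSpace fun _ => isCompact_Icc

instance [Nonempty X] (G : MetricRibbonGraph X n) : Nonempty G.Graph :=
  ⟨SeparationQuotient.mk (⟨Classical.arbitrary X, 0, ⟨le_rfl, (G.len_pos _).le⟩⟩ :
    G.graphGluing.Point)⟩

end MetricRibbonGraph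

/-! ## Hyperbolic quadrilaterals -/

namespace Hyp

/-- Fermi coordinates relative to the geodesic `i ℝ₊`: the point at signed distance `s` from the
point `i eᵗ`, on the geodesic perpendicular to `i ℝ₊` at that point, on the right for `s > 0`. -/
def fermi (t s : ℝ) : ℍ :=
  ⟨⟨Real.exp t * Real.tanh s, Real.exp t / Real.cosh s⟩, div_pos (Real.exp_pos _) (Real.cosh_pos _)⟩

/-- The geodesic segment between two points of the hyperbolic plane. -/
def seg (a b : ℍ) : Set ℍ := {z | dist a z + dist z b = dist a b}

/-- The foot of the perpendicular from `z` to the geodesic `i ℝ₊`. -/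
def foot (z : ℍ) : ℍ := ⟨⟨0, ‖(z : ℂ)‖⟩, norm_pos_iff.2 z.ne_zero⟩

/-- The position of `a` in the Poincaré disc centred at `z`. Geodesics issuing from `z` are radii
of this disc. -/
def diskCoord (z a : ℍ) : ℂ := ((a : ℂ) - z) / ((a : ℂ) - starRingEnd ℂ (z : ℂ))

/-- The hyperbolic angle at `z` between the geodesics from `z` to `a` and from `z` to `b`. -/
def angle (a z b : ℍ) : ℝ := InnerProductGeometry.angle (diskCoord z a) (diskCoord z b)

/-- The hyperbolic quadrilateral with right angles at the end points of the base, which is the segment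
of length `ℓ` from `i` to `i e^ℓ`, whose two remaining vertices lie at distances `r` and `r'`
from these end points: the union of all perpendiculars from the side opposite to the base (the
diagonal of the hexagon obtained by reflecting the quadrilateral in that side) to the base. -/
def quad (ℓ r r' : ℝ) : Set ℍ := {z | ∃ y ∈ seg (fermi 0 r) (fermi ℓ r'), z ∈ seg (foot y) y}

theorem left_mem_seg (a b : ℍ) : a ∈ seg a b := by simp [seg]

theorem right_mem_seg (a b : ℍ) : b ∈ seg a b := by simp [seg]

theorem continuous_foot : Continuous foot := by
  apply UpperHalfPlane.isEmbedding_coe.continuous_iff.2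
  have : Continuous fun z : ℍ => ((‖(z : ℂ)‖ : ℝ) : ℂ) * Complex.I :=
    (Complex.continuous_ofReal.comp UpperHalfPlane.continuous_coe.norm).mul continuous_const
  convert this using 2 with z
  simp [foot, Complex.ext_iff]

theorem isCompact_seg (a b : ℍ) : IsCompact (seg a b) := by
  apply Metric.isCompact_of_isClosed_isBounded
  · exact isClosed_eq (by fun_prop) continuous_const
  · refine (Metric.isBounded_closedBall (x := a) (r := dist a b)).subset fun z hz => ?_
    rw [Metric.mem_closedBall, dist_comm]
    have h : dist a z + dist z b = dist a b := hz
    linarith [dist_nonneg (x := z) (y := b)]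

theorem isCompact_quad (ℓ r r' : ℝ) : IsCompact (quad ℓ r r') := by
  set K := seg (fermi 0 r) (fermi ℓ r') with hK
  have hKc : IsCompact K := isCompact_seg _ _
  obtain ⟨C, hC⟩ := (hKc.image (continuous_foot.dist continuous_id)).bddAbove
  obtain ⟨R, hR⟩ := hKc.isBounded.subset_closedBall UpperHalfPlane.I
  let T : Set (ℍ × ℍ) := {p | p.1 ∈ K ∧ p.2 ∈ seg (foot p.1) p.1}
  have hT : IsCompact T := by
    apply Metric.isCompact_of_isClosed_isBounded
    · refine (hKc.isClosed.preimage continuous_fst).inter ?_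
      have hf : Continuous fun p : ℍ × ℍ => foot p.1 := continuous_foot.comp continuous_fst
      exact isClosed_eq (by fun_prop) (by fun_prop)
    · refine ((Metric.isBounded_closedBall (x := UpperHalfPlane.I) (r := R)).prod
        (Metric.isBounded_closedBall (x := UpperHalfPlane.I) (r := C + R))).subset ?_
      rintro ⟨y, z⟩ ⟨hy, hz⟩
      have h1 : dist y UpperHalfPlane.I ≤ R := hR hy
      have h2 : dist (foot y) y ≤ C := hC ⟨y, hy, rfl⟩
      have h3 : dist (foot y) z + dist z y = dist (foot y) y := hz
      refine ⟨h1, ?_⟩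
      rw [Metric.mem_closedBall]
      linarith [dist_triangle z y UpperHalfPlane.I, dist_nonneg (x := foot y) (y := z)]
  convert hT.image continuous_snd using 1
  ext z
  constructor
  · rintro ⟨y, hy, hz⟩
    exact ⟨(y, z), ⟨hy, hz⟩, rfl⟩
  · rintro ⟨⟨y, z⟩, ⟨hy, hz⟩, rfl⟩
    exact ⟨y, hy, hz⟩

end Hyp

/-! ## The inverse Bowditch–Epstein construction -/

namespace MetricRibbonGraph

variable {X : Type*} {n : ℕ}

section Pieces

variable (G : MetricRibbonGraph X n) (ρ : G.Vertex → ℝ) (x : X)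

/-- The quadrilateral on the left of the oriented edge `x`, given the lengths `ρ` of the ribs at the
vertices: its base is the boundary arc facing `x`, its right angles are at the end points of the
base, its sides adjacent to the base are ribs at the tail and the head of `x`, and the side opposite
to the base is the edge `x` of the spine.  Together with the quadrilateral of the reverse of `x` it
makes up a hexagon with four right angles. -/
def piece : Set ℍ := Hyp.quad (G.len x) (ρ (G.tail x)) (ρ (G.head x))

/-- The end points of the base. -/
def tailFoot (_G : MetricRibbonGraph X n) (_x : X) : ℍ := Hyp.fermi 0 0

def headFoot : ℍ := Hyp.fermi (G.len x) 0

/-- The corner at the tail of `x`. -/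
def tailCorner : ℍ := Hyp.fermi 0 (ρ (G.tail x))

/-- The corner at the head of `x`. -/
def headCorner : ℍ := Hyp.fermi (G.len x) (ρ (G.head x))

/-- The rib at the tail of `x`, as a side of the quadrilateral of `x`. -/
def tailRib : Set ℍ := Hyp.seg (G.tailFoot x) (G.tailCorner ρ x)

/-- The rib at the head of `x`, as a side of the quadrilateral of `x`. -/
def headRib : Set ℍ := Hyp.seg (G.headFoot x) (G.headCorner ρ x)

/-- The edge of the spine, as a side of the quadrilateral of `x`. -/
def spineSide : Set ℍ := Hyp.seg (G.tailCorner ρ x) (G.headCorner ρ x)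

/-- The angle of the quadrilateral of `x` at its corner at the tail of `x`. -/
def tailAngle : ℝ := Hyp.angle (G.tailFoot x) (G.tailCorner ρ x) (G.headCorner ρ x)

/-- The angle of the quadrilateral of `x` at its corner at the head of `x`. -/
def headAngle : ℝ := Hyp.angle (G.headFoot x) (G.headCorner ρ x) (G.tailCorner ρ x)

theorem tailCorner_mem_piece : G.tailCorner ρ x ∈ G.piece ρ x :=
  ⟨_, Hyp.left_mem_seg _ _, Hyp.right_mem_seg _ _⟩

theorem headCorner_mem_piece : G.headCorner ρ x ∈ G.piece ρ x :=
  ⟨_, Hyp.right_mem_seg _ _, Hyp.right_mem_seg _ _⟩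

end Pieces

open Classical in
/-- `ρ` is a system of rib lengths for `G`: positive numbers assigned to the vertices such that the
corners of the quadrilaterals which meet at a vertex have total angle `2π`.  At the
vertex `v` these are, for each oriented edge `x` pointing toward `v`, the corner at the head of
`x` and the corner at the tail of the reverse of `x`. -/
def IsRibLengths [Fintype X] (G : MetricRibbonGraph X n) (ρ : G.Vertex → ℝ) : Prop :=
  (∀ v, 0 < ρ v) ∧ ∀ v : G.Vertex,
    ∑ x ∈ Finset.univ.filter (fun x => G.head x = v),
      (G.headAngle ρ x + G.tailAngle ρ (G.s₁ x)) = 2 * Real.pi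

/-- The gluing of the quadrilaterals.  The spine sides of `x` and of its reverse are glued
isometrically, so that the tail of `x` matches the head of its reverse; the rib at the head of `x` is
glued isometrically to the rib at the tail of the next edge `s₂ x` along the face on the left, corner
to corner. -/
def surfaceGluing (G : MetricRibbonGraph X n) (ρ : G.Vertex → ℝ) : GluingData X ℍ where
  piece := G.piece ρ
  glue x a y b :=
    (y = G.s₁ x ∧ a ∈ G.spineSide ρ x ∧ b ∈ G.spineSide ρ y ∧
      dist a (G.tailCorner ρ x) = dist b (G.headCorner ρ y)) ∨
    (y = G.s₂ x ∧ a ∈ G.headRib ρ x ∧ b ∈ G.tailRib ρ y ∧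
      dist a (G.headCorner ρ x) = dist b (G.tailCorner ρ y))

/-- The surface obtained from the quadrilaterals with rib lengths `ρ`, with its path metric. -/
def GluedSurface (G : MetricRibbonGraph X n) (ρ : G.Vertex → ℝ) : Type _ :=
  (G.surfaceGluing ρ).Space

theorem surface_edist_ne_top (G : MetricRibbonGraph X n) (ρ : G.Vertex → ℝ)
    (p q : G.GluedSurface ρ) :
    @edist _ (inferInstanceAs (EDist (G.surfaceGluing ρ).Space)) p q ≠ ⊤ := by
  let D := G.surfaceGluing ρ
  let e : X → D.Point := fun x => ⟨x, G.headCorner ρ x, G.headCorner_mem_piece ρ x⟩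
  let e' : X → D.Point := fun x => ⟨x, G.tailCorner ρ x, G.tailCorner_mem_piece ρ x⟩
  have hee : ∀ x, edist (e' x) (e x) < ⊤ := fun x =>
    (D.edist_le_of_piece _ _).trans_lt (edist_lt_top _ _)
  have hE : Equivalence fun x y => edist (e x) (e y) < ⊤ := by
    refine ⟨fun x => by simp, fun {x y} h => by rwa [edist_comm], fun {x y z} h h' => ?_⟩
    exact (edist_triangle _ (e y) _).trans_lt (ENNReal.add_lt_top.2 ⟨h, h'⟩)
  have h1 : ∀ x, edist (e x) (e (G.s₁ x)) < ⊤ := by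
    intro x
    refine (edist_triangle _ (e' x) _).trans_lt (ENNReal.add_lt_top.2 ⟨?_, ?_⟩)
    · rw [edist_comm]
      exact hee x
    · have hg : D.glue x (G.tailCorner ρ x) (G.s₁ x) (G.headCorner ρ (G.s₁ x)) :=
        Or.inl ⟨rfl, Hyp.left_mem_seg _ _, Hyp.right_mem_seg _ _, by rw [dist_self, dist_self]⟩
      rw [D.edist_eq_zero_of_glue (p := e' x) (q := e (G.s₁ x)) hg]
      exact ENNReal.zero_lt_top
  have h2 : ∀ x, edist (e x) (e (G.s₂ x)) < ⊤ := by
    intro x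
    refine (edist_triangle _ (e' (G.s₂ x)) _).trans_lt (ENNReal.add_lt_top.2 ⟨?_, hee _⟩)
    have hg : D.glue x (G.headCorner ρ x) (G.s₂ x) (G.tailCorner ρ (G.s₂ x)) :=
      Or.inr ⟨rfl, Hyp.right_mem_seg _ _, Hyp.right_mem_seg _ _, by rw [dist_self, dist_self]⟩
    rw [D.edist_eq_zero_of_glue (p := e x) (q := e' (G.s₂ x)) hg]
    exact ENNReal.zero_lt_top
  have key : ∀ x y, edist (e x) (e y) < ⊤ := by
    refine G.rel_of_connected hE (fun x => ?_) h1
    refine hE.symm (hE.trans (h2 (G.s₀ x)) ?_)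
    have hs : G.s₂ (G.s₀ x) = G.s₁ x := by simp [RibbonGraph.s₂]
    rw [hs]
    exact hE.symm (h1 x)
  have toe : ∀ p : D.Point, edist p (e p.idx) < ⊤ := fun p =>
    (D.edist_le_of_piece p.mem _).trans_lt (edist_lt_top _ _)
  obtain ⟨p, rfl⟩ := SeparationQuotient.surjective_mk p
  obtain ⟨q, rfl⟩ := SeparationQuotient.surjective_mk q
  refine ne_of_lt (b := ⊤) (?_ : edist p q < ⊤)
  refine (edist_triangle _ (e p.idx) _).trans_lt (ENNReal.add_lt_top.2 ⟨toe p, ?_⟩)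
  refine (edist_triangle _ (e q.idx) _).trans_lt (ENNReal.add_lt_top.2 ⟨key _ _, ?_⟩)
  rw [edist_comm]
  exact toe q

instance (G : MetricRibbonGraph X n) (ρ : G.Vertex → ℝ) : MetricSpace (G.GluedSurface ρ) :=
  @EMetricSpace.toMetricSpace _ (inferInstanceAs (EMetricSpace (G.surfaceGluing ρ).Space))
    (G.surface_edist_ne_top ρ)

instance [Finite X] (G : MetricRibbonGraph X n) (ρ : G.Vertex → ℝ) :
    CompactSpace (G.GluedSurface ρ) :=
  (G.surfaceGluing ρ).compactSpace fun _ => Hyp.isCompact_quad _ _ _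

instance [Nonempty X] (G : MetricRibbonGraph X n) (ρ : G.Vertex → ℝ) :
    Nonempty (G.GluedSurface ρ) :=
  ⟨SeparationQuotient.mk (⟨Classical.arbitrary X, _, G.headCorner_mem_piece ρ _⟩ :
    (G.surfaceGluing ρ).Point)⟩

/-- The rib lengths of the hyperbolic surface with spine `G`. -/
def ribLengths [Fintype X] (G : MetricRibbonGraph X n) : G.Vertex → ℝ :=
  Classical.epsilon fun ρ => G.IsRibLengths ρ

/-- The hyperbolic surface `S(G)` with spine `G`, glued from quadrilaterals (halves of the hexagons
cut out by the ribs) whose corners fit together smoothly at the vertices of the spine. -/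
abbrev Surface [Fintype X] (G : MetricRibbonGraph X n) : Type _ := G.GluedSurface G.ribLengths

end MetricRibbonGraph

end

/-!
The corner of the quadrilateral of an edge of length `l` at the vertex with rib `r` has an angle
that increases with the other rib `r'` and decreases with `r`. The angles at all vertices are at
least `2 π` for small constant rib lengths, and only for bounded rib lengths. Hence some rib lengths
with this property have maximal sum, and then all the angles are equal to `2 π`. Uniqueness is a
maximum principle: with the Gudermannian of the rib lengths as coordinate, raising both ribs by the
same amount decreases the corner angle. The bound on the ribs is uniform over graphs whose edges
have length at least `m`, so the ribs of `S(N Γ)` are bounded by some `R` independent of `N ≥ 1`.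

The projection of each quadrilateral to its base is `1`-Lipschitz and compatible with the gluing,
hence defines a map from `S(N Γ)` to `N Γ`. Mapping each edge affinely onto the edge of the spine is
an approximate inverse, up to `3 R`, with Lipschitz constant at most `1 + 2 R / (N m)`. After
rescaling by `1 / N`, both errors tend to zero.
-/

noncomputable section

/-! ## The hyperboloid model -/

section Minkowski

variable {E : Type*} [NormedAddCommGroup E] [InnerProductSpace ℝ E]

/-- The Lorentzian form `v₁ w₁ - ⟪v₂, w₂⟫` on `ℝ × E`, whose first factor is the time axis. -/
def minkowski : LinearMap.BilinForm ℝ (ℝ × E) :=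
  (LinearMap.mul ℝ ℝ).compl₁₂ (LinearMap.fst ℝ ℝ E) (LinearMap.fst ℝ ℝ E) -
    (innerₗ E).compl₁₂ (LinearMap.snd ℝ ℝ E) (LinearMap.snd ℝ ℝ E)

theorem minkowski_apply (v w : ℝ × E) : minkowski v w = v.1 * w.1 - inner ℝ v.2 w.2 := rfl

theorem minkowski_comm (v w : ℝ × E) : minkowski v w = minkowski w v := by
  rw [minkowski_apply, minkowski_apply, mul_comm, real_inner_comm]

theorem eq_zero_of_minkowski_eq_zero {u v : ℝ × E} (hv : 0 < minkowski v v)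
    (hvu : minkowski v u = 0) (hu : 0 ≤ minkowski u u) : u = 0 := by
  simp only [minkowski_apply, real_inner_self_eq_norm_mul_norm] at hv hvu hu
  have hu₁ : ‖u.2‖ ≤ |u.1| := abs_norm u.2 ▸ abs_le_iff_mul_self_le.2 (by linarith)
  have hv₁ : ‖v.2‖ < |v.1| := abs_norm v.2 ▸ abs_lt_iff_mul_self_lt.2 (by linarith)
  have cauchySchwarz : |v.1| * |u.1| ≤ ‖v.2‖ * ‖u.2‖ := by
    rw [← abs_mul, sub_eq_zero.1 hvu]
    exact abs_real_inner_le_norm _ _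
  have hu₀ : |u.1| = 0 := by
    by_contra h
    have : 0 < |u.1| := (abs_nonneg _).lt_of_ne' h
    exact cauchySchwarz.not_gt
      ((mul_le_mul_of_nonneg_left hu₁ (norm_nonneg _)).trans_lt (mul_lt_mul_of_pos_right hv₁ this))
  exact Prod.ext (abs_eq_zero.1 hu₀) (norm_le_zero_iff.1 (hu₀ ▸ hu₁))

end Minkowski

namespace Hyp

/-- The isometry from the upper half plane to the upper sheet of the unit hyperboloid for
`minkowski`. It sends `i` to the time unit vector and the geodesic `i ℝ₊` to the real plane. -/
def hyperboloid (z : ℍ) : ℝ × ℂ :=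
  ((z.re ^ 2 + z.im ^ 2 + 1) / (2 * z.im), ⟨z.re / z.im, (z.re ^ 2 + z.im ^ 2 - 1) / (2 * z.im)⟩)

theorem hyperboloid_fst_pos (z : ℍ) : 0 < (hyperboloid z).1 := by
  have := z.im_pos
  unfold hyperboloid
  positivity

theorem minkowski_hyperboloid (z w : ℍ) :
    minkowski (hyperboloid z) (hyperboloid w) = Real.cosh (dist z w) := by
  have hdist : dist (z : ℂ) w ^ 2 = (z.re - w.re) ^ 2 + (z.im - w.im) ^ 2 := by
    rw [Complex.dist_eq, ← Complex.normSq_eq_norm_sq, Complex.normSq_apply]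
    simp only [Complex.sub_re, Complex.sub_im, UpperHalfPlane.coe_re, UpperHalfPlane.coe_im]
    ring
  rw [UpperHalfPlane.cosh_dist, hdist, minkowski_apply, Complex.inner]
  simp only [hyperboloid, Complex.mul_re, Complex.conj_re, Complex.conj_im]
  field_simp
  ring

theorem minkowski_hyperboloid_self (z : ℍ) : minkowski (hyperboloid z) (hyperboloid z) = 1 := by
  rw [minkowski_hyperboloid, dist_self, Real.cosh_zero]

theorem dist_eq_abs_of_cosh_eq {a : ℝ} {z w : ℍ} (h : Real.cosh (dist z w) = Real.cosh a) :
    dist z w = |a| := by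
  rw [← abs_of_nonneg (dist_nonneg (x := z) (y := w))]
  exact le_antisymm (Real.cosh_le_cosh.1 h.le) (Real.cosh_le_cosh.1 h.ge)

theorem hyperboloid_injective : Function.Injective hyperboloid := fun z w h => by
  rw [← dist_eq_zero, ← abs_zero]
  apply dist_eq_abs_of_cosh_eq
  rw [← minkowski_hyperboloid, h, minkowski_hyperboloid_self, Real.cosh_zero]

theorem exists_hyperboloid_eq {v : ℝ × ℂ} (hv : minkowski v v = 1) (hv₀ : 0 < v.1) :
    ∃ z, hyperboloid z = v := by
  obtain ⟨c, a, b⟩ := v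
  have hc : c ^ 2 = 1 + a ^ 2 + b ^ 2 := by
    simp only [minkowski_apply, Complex.inner, Complex.mul_re, Complex.conj_re,
      Complex.conj_im] at hv
    linarith
  have hbc : 0 < c - b := sub_pos.2 (lt_of_pow_lt_pow_left₀ 2 hv₀.le (by nlinarith [sq_nonneg a]))
  refine ⟨⟨⟨a / (c - b), 1 / (c - b)⟩, one_div_pos.2 hbc⟩, Prod.ext ?_ (Complex.ext ?_ ?_)⟩ <;>
    simp only [hyperboloid, UpperHalfPlane.re, UpperHalfPlane.im] <;> field_simp <;> linarith

theorem hyperboloid_of_mem_seg {A B z : ℍ} (h : z ∈ seg A B) :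
    Real.sinh (dist A B) • hyperboloid z =
      Real.sinh (dist z B) • hyperboloid A + Real.sinh (dist A z) • hyperboloid B := by
  replace h : dist A B = dist A z + dist z B := h.symm
  set U := Real.sinh (dist A B) • hyperboloid z -
    (Real.sinh (dist z B) • hyperboloid A + Real.sinh (dist A z) • hyperboloid B) with hU
  have apply_U (v : ℝ × ℂ) : minkowski v U = Real.sinh (dist A B) * minkowski v (hyperboloid z) -
      (Real.sinh (dist z B) * minkowski v (hyperboloid A) +
        Real.sinh (dist A z) * minkowski v (hyperboloid B)) := by
    simp only [hU, map_sub, map_add, map_smul, smul_eq_mul]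
  have hA : minkowski (hyperboloid A) U = 0 := by
    rw [apply_U]
    simp only [minkowski_hyperboloid, dist_self, Real.cosh_zero, h, Real.sinh_add, Real.cosh_add]
    linear_combination Real.sinh (dist z B) * Real.cosh_sq (dist A z)
  have hB : minkowski (hyperboloid B) U = 0 := by
    rw [apply_U]
    simp only [minkowski_hyperboloid, dist_comm B, dist_self, Real.cosh_zero, h, Real.sinh_add,
      Real.cosh_add]
    linear_combination Real.sinh (dist A z) * Real.cosh_sq (dist z B)
  have hz : minkowski (hyperboloid z) U = 0 := by
    rw [apply_U]
    simp only [minkowski_hyperboloid, dist_comm z A, dist_self, Real.cosh_zero, h, Real.sinh_add]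
    ring
  have hUU : minkowski U U = 0 := by
    rw [apply_U, minkowski_comm U, minkowski_comm U, minkowski_comm U, hA, hB, hz]
    simp only [mul_zero, add_zero, sub_zero]
  exact sub_eq_zero.1 (eq_zero_of_minkowski_eq_zero
    (by rw [minkowski_hyperboloid_self]; exact one_pos) hA hUU.ge)

theorem eq_of_mem_seg {A B z w : ℍ} (hz : z ∈ seg A B) (hw : w ∈ seg A B)
    (h : dist A z = dist A w) : z = w := by
  have hz' : dist A z + dist z B = dist A B := hz
  have hw' : dist A w + dist w B = dist A B := hw
  have hB : dist z B = dist w B := by linarith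
  rcases eq_or_ne A B with rfl | hne
  · rw [dist_self] at hz'
    have hzA : dist A z = 0 := by linarith [dist_comm A z]
    exact (dist_eq_zero.1 hzA).symm.trans (dist_eq_zero.1 (h ▸ hzA))
  · refine hyperboloid_injective (smul_right_injective _
      (Real.sinh_pos_iff.2 (dist_pos.2 hne)).ne' ?_)
    simp only [hyperboloid_of_mem_seg hz, hyperboloid_of_mem_seg hw, h, hB]

theorem minkowski_interpolate {A B : ℍ} {d : ℝ} (hd : dist A B = d) (s t : ℝ) :
    minkowski (Real.sinh (d - s) • hyperboloid A + Real.sinh s • hyperboloid B)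
      (Real.sinh (d - t) • hyperboloid A + Real.sinh t • hyperboloid B) =
      Real.sinh d ^ 2 * Real.cosh (s - t) := by
  simp only [map_add, map_smul, LinearMap.add_apply, LinearMap.smul_apply, smul_eq_mul,
    minkowski_hyperboloid, dist_comm B A, dist_self, Real.cosh_zero, hd, Real.sinh_sub,
    Real.cosh_sub]
  linear_combination -(Real.sinh s * Real.sinh t) * Real.cosh_sq d

theorem exists_geodesic_point {A B : ℍ} (hAB : A ≠ B) {t : ℝ} (ht : t ∈ Set.Icc 0 (dist A B)) :
    ∃ z, Real.sinh (dist A B) • hyperboloid z =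
      Real.sinh (dist A B - t) • hyperboloid A + Real.sinh t • hyperboloid B := by
  have hd : 0 < Real.sinh (dist A B) := Real.sinh_pos_iff.2 (dist_pos.2 hAB)
  set v := Real.sinh (dist A B - t) • hyperboloid A + Real.sinh t • hyperboloid B
  have hvv : minkowski v v = Real.sinh (dist A B) ^ 2 := by
    rw [minkowski_interpolate rfl, sub_self, Real.cosh_zero, mul_one]
  have hv₁ : v.1 = Real.sinh (dist A B - t) * (hyperboloid A).1 + Real.sinh t * (hyperboloid B).1 :=
    rfl
  have hv₀ : 0 < v.1 := by
    rw [hv₁]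
    rcases ht.2.lt_or_eq with h | h
    · exact add_pos_of_pos_of_nonneg
        (mul_pos (Real.sinh_pos_iff.2 (sub_pos.2 h)) (hyperboloid_fst_pos A))
        (mul_nonneg (Real.sinh_nonneg_iff.2 ht.1) (hyperboloid_fst_pos B).le)
    · rw [h, sub_self, Real.sinh_zero, zero_mul, zero_add]
      exact mul_pos hd (hyperboloid_fst_pos B)
  obtain ⟨z, hz⟩ := exists_hyperboloid_eq (v := (Real.sinh (dist A B))⁻¹ • v)
    (by simp only [map_smul, LinearMap.smul_apply, smul_eq_mul, hvv]; field_simp)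
    (mul_pos (inv_pos.2 hd) hv₀)
  exact ⟨z, by rw [hz, smul_inv_smul₀ hd.ne']⟩

theorem exists_geodesic (A B : ℍ) : ∃ γ : ℝ → ℍ, γ 0 = A ∧ γ (dist A B) = B ∧
    ∀ s ∈ Set.Icc 0 (dist A B), ∀ t ∈ Set.Icc 0 (dist A B), dist (γ s) (γ t) = |s - t| := by
  rcases eq_or_ne A B with rfl | hne
  · refine ⟨fun _ => A, rfl, rfl, fun s hs t ht => ?_⟩
    rw [dist_self, Set.Icc_self, Set.mem_singleton_iff] at hs ht
    rw [hs, ht, sub_self, abs_zero, dist_self]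
  have hd : Real.sinh (dist A B) ≠ 0 := (Real.sinh_pos_iff.2 (dist_pos.2 hne)).ne'
  choose! γ hγ using fun t (ht : t ∈ Set.Icc 0 (dist A B)) => exists_geodesic_point hne ht
  refine ⟨γ, hyperboloid_injective (smul_right_injective _ hd ?_),
    hyperboloid_injective (smul_right_injective _ hd ?_), fun s hs t ht => ?_⟩
  · simp only [hγ 0 ⟨le_rfl, dist_nonneg⟩, sub_zero, Real.sinh_zero, zero_smul, add_zero]
  · simp only [hγ _ ⟨dist_nonneg, le_rfl⟩, sub_self, Real.sinh_zero, zero_smul, zero_add]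
  · apply dist_eq_abs_of_cosh_eq
    have h := minkowski_interpolate (A := A) (B := B) rfl s t
    rw [← hγ s hs, ← hγ t ht] at h
    simp only [map_smul, LinearMap.smul_apply, smul_eq_mul, minkowski_hyperboloid] at h
    exact mul_left_cancel₀ (pow_ne_zero 2 hd) (by linarith)

/-- A unit speed parametrisation of the segment from `A` to `B` on `[0, dist A B]`; its values
outside this interval are junk. -/
def geodesic (A B : ℍ) : ℝ → ℍ := (exists_geodesic A B).choose

theorem geodesic_zero (A B : ℍ) : geodesic A B 0 = A := (exists_geodesic A B).choose_spec.1

theorem geodesic_dist (A B : ℍ) : geodesic A B (dist A B) = B :=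
  (exists_geodesic A B).choose_spec.2.1

theorem dist_geodesic {A B : ℍ} {s t : ℝ} (hs : s ∈ Set.Icc 0 (dist A B))
    (ht : t ∈ Set.Icc 0 (dist A B)) : dist (geodesic A B s) (geodesic A B t) = |s - t| :=
  (exists_geodesic A B).choose_spec.2.2 s hs t ht

theorem dist_left_geodesic {A B : ℍ} {t : ℝ} (ht : t ∈ Set.Icc 0 (dist A B)) :
    dist A (geodesic A B t) = t := by
  have h := dist_geodesic ⟨le_rfl, dist_nonneg⟩ ht
  rwa [geodesic_zero, zero_sub, abs_neg, abs_of_nonneg ht.1] at h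

theorem dist_geodesic_right {A B : ℍ} {t : ℝ} (ht : t ∈ Set.Icc 0 (dist A B)) :
    dist (geodesic A B t) B = dist A B - t := by
  have h := dist_geodesic ht ⟨dist_nonneg, le_rfl⟩
  rwa [geodesic_dist, abs_sub_comm, abs_of_nonneg (sub_nonneg.2 ht.2)] at h

theorem geodesic_mem_seg {A B : ℍ} {t : ℝ} (ht : t ∈ Set.Icc 0 (dist A B)) :
    geodesic A B t ∈ seg A B := by
  change dist A _ + dist _ B = dist A B
  rw [dist_left_geodesic ht, dist_geodesic_right ht, add_sub_cancel]

theorem dist_mem_Icc_of_mem_seg {A B y : ℍ} (hy : y ∈ seg A B) :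
    dist A y ∈ Set.Icc 0 (dist A B) :=
  have h : dist A y + dist y B = dist A B := hy
  ⟨dist_nonneg, h ▸ le_add_of_nonneg_right dist_nonneg⟩

theorem geodesic_dist_left {A B y : ℍ} (hy : y ∈ seg A B) : geodesic A B (dist A y) = y :=
  have ht := dist_mem_Icc_of_mem_seg hy
  eq_of_mem_seg (geodesic_mem_seg ht) hy (dist_left_geodesic ht)

theorem seg_comm (A B : ℍ) : seg A B = seg B A := by
  ext z
  simp only [seg, Set.mem_ofPred_eq, dist_comm B, dist_comm _ A, add_comm]

theorem isometry_mem_seg {f : ℍ → ℍ} (hf : Isometry f) {A B z : ℍ} (h : z ∈ seg A B) :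
    f z ∈ seg (f A) (f B) := by
  simpa only [seg, Set.mem_ofPred_eq, hf.dist_eq] using h

theorem exists_hyperboloid_eq_of_mem_seg {A B z : ℍ} (h : z ∈ seg A B) :
    ∃ a b : ℝ, 0 ≤ a ∧ 0 ≤ b ∧ a + b ≤ 1 ∧
      hyperboloid z = a • hyperboloid A + b • hyperboloid B := by
  have hd : dist A z + dist z B = dist A B := h
  rcases eq_or_ne A B with rfl | hne
  · have hz : dist A z = 0 := by linarith [dist_self A, dist_comm A z]
    exact ⟨1, 0, zero_le_one, le_rfl, by norm_num, by
      rw [dist_eq_zero.1 hz, one_smul, zero_smul, add_zero]⟩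
  · have hpos : 0 < Real.sinh (dist A B) := Real.sinh_pos_iff.2 (dist_pos.2 hne)
    have hp : 0 ≤ Real.sinh (dist z B) := Real.sinh_nonneg_iff.2 dist_nonneg
    have hq : 0 ≤ Real.sinh (dist A z) := Real.sinh_nonneg_iff.2 dist_nonneg
    refine ⟨Real.sinh (dist z B) / Real.sinh (dist A B),
      Real.sinh (dist A z) / Real.sinh (dist A B), by positivity, by positivity, ?_, ?_⟩
    · rw [← add_div, div_le_one hpos, ← hd, Real.sinh_add]
      nlinarith [Real.one_le_cosh (dist A z), Real.one_le_cosh (dist z B)]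
    · rw [div_eq_inv_mul, div_eq_inv_mul, mul_smul, mul_smul, ← smul_add,
        ← hyperboloid_of_mem_seg h, inv_smul_smul₀ hpos.ne']

/-- The Fermi coordinate along the axis `i ℝ₊`: the signed distance from `i` to the foot of the
perpendicular from `z`. -/
def proj (z : ℍ) : ℝ := Real.log ‖(z : ℂ)‖

/-- The Fermi coordinate across the axis `i ℝ₊`: the signed distance from `z` to the axis. -/
def height (z : ℍ) : ℝ := Real.arsinh (z.re / z.im)

theorem norm_eq_im_mul_cosh_height (z : ℍ) : ‖(z : ℂ)‖ = z.im * Real.cosh (height z) := by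
  have := z.im_pos
  rw [← sq_eq_sq₀ (norm_nonneg _) (by positivity), mul_pow, Real.cosh_sq, height,
    Real.sinh_arsinh, ← Complex.normSq_eq_norm_sq, Complex.normSq_apply, UpperHalfPlane.coe_re,
    UpperHalfPlane.coe_im]
  field_simp

theorem fermi_proj_height (z : ℍ) : fermi (proj z) (height z) = z := by
  have hz := norm_eq_im_mul_cosh_height z
  have hcosh := (Real.cosh_pos (height z)).ne'
  refine UpperHalfPlane.ext (Complex.ext ?_ ?_)
  · change Real.exp (proj z) * Real.tanh (height z) = z.re
    rw [proj, Real.exp_log (norm_pos_iff.2 z.ne_zero), hz, Real.tanh_eq_sinh_div_cosh, mul_assoc,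
      mul_div_cancel₀ _ hcosh, height, Real.sinh_arsinh, mul_div_cancel₀ _ z.im_pos.ne']
  · change Real.exp (proj z) / Real.cosh (height z) = z.im
    rw [proj, Real.exp_log (norm_pos_iff.2 z.ne_zero), hz, mul_div_cancel_right₀ _ hcosh]

theorem hyperboloid_fermi (t s : ℝ) : hyperboloid (fermi t s) =
    (Real.cosh s * Real.cosh t, ⟨Real.sinh s, Real.cosh s * Real.sinh t⟩) := by
  simp only [hyperboloid, UpperHalfPlane.re, UpperHalfPlane.im, fermi, Real.cosh_eq t,
    Real.sinh_eq t, Real.exp_neg, Real.tanh_eq_sinh_div_cosh]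
  refine Prod.ext ?_ (Complex.ext ?_ ?_) <;> field_simp <;> rw [Real.cosh_sq s] <;> ring

theorem height_fermi (t s : ℝ) : height (fermi t s) = s := by
  have h : (fermi t s).re / (fermi t s).im = Real.sinh s :=
    congrArg (fun v => v.2.re) (hyperboloid_fermi t s)
  rw [height, h, Real.arsinh_sinh]

theorem proj_fermi (t s : ℝ) : proj (fermi t s) = t := by
  rw [proj, norm_eq_im_mul_cosh_height, height_fermi]
  change Real.log (Real.exp t / Real.cosh s * Real.cosh s) = t
  rw [div_mul_cancel₀ _ (Real.cosh_pos s).ne', Real.log_exp]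

theorem foot_eq_fermi (z : ℍ) : foot z = fermi (proj z) 0 := by
  apply UpperHalfPlane.ext
  simp only [foot, fermi, proj, Real.exp_log (norm_pos_iff.2 z.ne_zero), Real.tanh_zero,
    Real.cosh_zero, mul_zero, div_one]

theorem hyperboloid_eq (z : ℍ) : hyperboloid z = (Real.cosh (height z) * Real.cosh (proj z),
    ⟨Real.sinh (height z), Real.cosh (height z) * Real.sinh (proj z)⟩) := by
  rw [← hyperboloid_fermi, fermi_proj_height]

theorem cosh_dist (z w : ℍ) : Real.cosh (dist z w) =
    Real.cosh (height z) * Real.cosh (height w) * Real.cosh (proj z - proj w) -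
      Real.sinh (height z) * Real.sinh (height w) := by
  rw [← minkowski_hyperboloid, hyperboloid_eq, hyperboloid_eq, minkowski_apply, Complex.inner,
    Complex.mul_re, Complex.conj_re, Complex.conj_im, Real.cosh_sub]
  ring

theorem dist_of_proj_eq {z w : ℍ} (h : proj z = proj w) : dist z w = |height z - height w| := by
  apply dist_eq_abs_of_cosh_eq
  rw [cosh_dist, h, sub_self, Real.cosh_zero, mul_one, Real.cosh_sub]

theorem dist_of_height_eq_zero {z w : ℍ} (hz : height z = 0) (hw : height w = 0) :
    dist z w = |proj z - proj w| := by
  apply dist_eq_abs_of_cosh_eq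
  rw [cosh_dist, hz, hw, Real.cosh_zero, Real.sinh_zero, one_mul, one_mul, mul_zero, sub_zero]

theorem abs_proj_sub_le_dist (z w : ℍ) : |proj z - proj w| ≤ dist z w := by
  rw [← abs_of_nonneg (dist_nonneg (x := z) (y := w)), ← Real.cosh_le_cosh, cosh_dist]
  have h₁ := Real.one_le_cosh (height z - height w)
  have h₂ := Real.one_le_cosh (proj z - proj w)
  have h₃ := one_le_mul_of_one_le_of_one_le (Real.one_le_cosh (height z))
    (Real.one_le_cosh (height w))
  rw [Real.cosh_sub] at h₁
  nlinarith

theorem dist_le_height_add_proj_add_height (z w : ℍ) :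
    dist z w ≤ |height z| + |proj z - proj w| + |height w| := by
  have hz : dist z (fermi (proj z) 0) = |height z| := by
    rw [dist_of_proj_eq (proj_fermi _ _).symm, height_fermi, sub_zero]
  have hw : dist (fermi (proj w) 0) w = |height w| := by
    rw [dist_of_proj_eq (proj_fermi _ _), height_fermi, zero_sub, abs_neg]
  have h : dist (fermi (proj z) 0) (fermi (proj w) 0) = |proj z - proj w| := by
    rw [dist_of_height_eq_zero (height_fermi _ _) (height_fermi _ _), proj_fermi, proj_fermi]
  rw [← hz, ← hw, ← h]
  exact dist_triangle4 _ _ _ _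

/-- The reflection of the hyperbolic plane exchanging `i` and `i e^l`. -/
def reflect (l : ℝ) (z : ℍ) : ℍ := fermi (l - proj z) (height z)

theorem reflect_fermi (l t s : ℝ) : reflect l (fermi t s) = fermi (l - t) s := by
  rw [reflect, proj_fermi, height_fermi]

theorem isometry_reflect (l : ℝ) : Isometry (reflect l) := Isometry.of_dist_eq fun z w => by
  rw [← abs_of_nonneg (dist_nonneg (x := z) (y := w))]
  apply dist_eq_abs_of_cosh_eq
  rw [cosh_dist, cosh_dist, reflect, reflect, height_fermi, height_fermi, proj_fermi, proj_fermi,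
    sub_sub_sub_cancel_left, ← Real.cosh_neg (proj w - proj z), neg_sub]

section Convexity

variable {A B z : ℍ}

theorem height_nonneg_of_mem_seg (hA : 0 ≤ height A) (hB : 0 ≤ height B) (hz : z ∈ seg A B) :
    0 ≤ height z := by
  obtain ⟨a, b, ha, hb, -, hz⟩ := exists_hyperboloid_eq_of_mem_seg hz
  have h : Real.sinh (height z) = a * Real.sinh (height A) + b * Real.sinh (height B) := by
    simpa [hyperboloid_eq] using congrArg (fun v => v.2.re) hz
  rw [← Real.sinh_nonneg_iff] at hA hB ⊢
  rw [h]
  positivity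

theorem height_le_of_mem_seg {R : ℝ} (hR : 0 ≤ R) (hA : height A ≤ R) (hB : height B ≤ R)
    (hz : z ∈ seg A B) : height z ≤ R := by
  obtain ⟨a, b, ha, hb, hab, hz⟩ := exists_hyperboloid_eq_of_mem_seg hz
  have h : Real.sinh (height z) = a * Real.sinh (height A) + b * Real.sinh (height B) := by
    simpa [hyperboloid_eq] using congrArg (fun v => v.2.re) hz
  rw [← Real.sinh_nonneg_iff] at hR
  rw [← Real.sinh_le_sinh] at hA hB ⊢
  calc Real.sinh (height z) ≤ a * Real.sinh R + b * Real.sinh R := by rw [h]; gcongr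
    _ = (a + b) * Real.sinh R := by ring
    _ ≤ Real.sinh R := mul_le_of_le_one_left hR hab

theorem proj_nonneg_of_mem_seg (hA : 0 ≤ proj A) (hB : 0 ≤ proj B) (hz : z ∈ seg A B) :
    0 ≤ proj z := by
  obtain ⟨a, b, ha, hb, -, hz⟩ := exists_hyperboloid_eq_of_mem_seg hz
  have h : Real.cosh (height z) * Real.sinh (proj z) =
      a * (Real.cosh (height A) * Real.sinh (proj A)) +
        b * (Real.cosh (height B) * Real.sinh (proj B)) := by
    simpa [hyperboloid_eq] using congrArg (fun v => v.2.im) hz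
  rw [← Real.sinh_nonneg_iff] at hA hB ⊢
  refine (mul_nonneg_iff_of_pos_left (Real.cosh_pos (height z))).1 ?_
  rw [h]
  positivity

theorem proj_le_of_mem_seg {c : ℝ} (hA : proj A ≤ c) (hB : proj B ≤ c) (hz : z ∈ seg A B) :
    proj z ≤ c := by
  have h := proj_nonneg_of_mem_seg (by rw [reflect, proj_fermi, sub_nonneg]; exact hA)
    (by rw [reflect, proj_fermi, sub_nonneg]; exact hB) (isometry_mem_seg (isometry_reflect c) hz)
  rwa [reflect, proj_fermi, sub_nonneg] at h

theorem le_proj_of_mem_seg {c : ℝ} (hA : c ≤ proj A) (hB : c ≤ proj B) (hz : z ∈ seg A B) :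
    c ≤ proj z := by
  have h := proj_le_of_mem_seg (c := 0)
    (by rw [reflect, proj_fermi, sub_nonpos]; exact hA)
    (by rw [reflect, proj_fermi, sub_nonpos]; exact hB) (isometry_mem_seg (isometry_reflect c) hz)
  rwa [reflect, proj_fermi, sub_nonpos] at h

theorem proj_eq_of_mem_seg (h : proj A = proj B) (hz : z ∈ seg A B) : proj z = proj A :=
  le_antisymm (proj_le_of_mem_seg le_rfl h.ge hz) (le_proj_of_mem_seg le_rfl h.le hz)

end Convexity

section Quadrilateral

variable {l r r' : ℝ}

theorem proj_mem_Icc_of_mem_side (hl : 0 ≤ l) {y : ℍ} (hy : y ∈ seg (fermi 0 r) (fermi l r')) :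
    proj y ∈ Set.Icc 0 l := by
  constructor
  · refine le_proj_of_mem_seg ?_ ?_ hy <;> rw [proj_fermi]
    exact hl
  · refine proj_le_of_mem_seg ?_ ?_ hy <;> rw [proj_fermi]
    exact hl

theorem abs_height_le_of_mem_side {R : ℝ} (hr : r ∈ Set.Icc 0 R) (hr' : r' ∈ Set.Icc 0 R) {y : ℍ}
    (hy : y ∈ seg (fermi 0 r) (fermi l r')) : |height y| ≤ R := by
  rw [abs_of_nonneg]
  · refine height_le_of_mem_seg (hr.1.trans hr.2) ?_ ?_ hy <;> rw [height_fermi]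
    exacts [hr.2, hr'.2]
  · refine height_nonneg_of_mem_seg ?_ ?_ hy <;> rw [height_fermi]
    exacts [hr.1, hr'.1]

theorem reflect_mem_side {y : ℍ} (hy : y ∈ seg (fermi 0 r) (fermi l r')) :
    reflect l y ∈ seg (fermi 0 r') (fermi l r) := by
  have h := isometry_mem_seg (isometry_reflect l) hy
  rwa [reflect_fermi, reflect_fermi, sub_zero, sub_self, seg_comm] at h

theorem dist_corners_comm (l r r' : ℝ) :
    dist (fermi 0 r) (fermi l r') = dist (fermi 0 r') (fermi l r) := by
  rw [← (isometry_reflect l).dist_eq, reflect_fermi, reflect_fermi, sub_zero, sub_self, dist_comm]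

theorem proj_add_proj_of_mem_side {a b : ℍ} (ha : a ∈ seg (fermi 0 r) (fermi l r'))
    (hb : b ∈ seg (fermi 0 r') (fermi l r)) (h : dist a (fermi 0 r) = dist b (fermi l r)) :
    proj a + proj b = l := by
  have hdist : dist (fermi 0 r) a = dist (fermi 0 r) (reflect l b) := by
    rw [dist_comm, h, ← (isometry_reflect l).dist_eq, reflect_fermi, sub_self, dist_comm]
  rw [eq_of_mem_seg ha (reflect_mem_side hb) hdist, reflect, proj_fermi, sub_add_cancel]

theorem exists_mem_side_of_mem_quad {R : ℝ} (hr : r ∈ Set.Icc 0 R) (hr' : r' ∈ Set.Icc 0 R) {z : ℍ}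
    (hz : z ∈ quad l r r') :
    ∃ y ∈ seg (fermi 0 r) (fermi l r'), proj z = proj y ∧ dist z y ≤ R := by
  obtain ⟨y, hy, hz⟩ := hz
  have hproj : proj (foot y) = proj y := by rw [foot_eq_fermi, proj_fermi]
  have hdist : dist (foot y) y = |height y| := by
    rw [dist_of_proj_eq hproj, foot_eq_fermi, height_fermi, zero_sub, abs_neg]
  have hzy : dist z y ≤ dist (foot y) y := by
    have h : dist (foot y) z + dist z y = dist (foot y) y := hz
    exact h ▸ le_add_of_nonneg_left dist_nonneg
  exact ⟨y, hy, (proj_eq_of_mem_seg hproj hz).trans hproj,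
    hzy.trans (hdist.trans_le (abs_height_le_of_mem_side hr hr' hy))⟩

end Quadrilateral

end Hyp

/-! ## Corner angles -/

namespace Hyp

theorem norm_diskCoord (z a : ℍ) : ‖diskCoord z a‖ = Real.tanh (dist z a / 2) := by
  rw [dist_comm, UpperHalfPlane.tanh_half_dist, diskCoord, norm_div, Complex.dist_eq,
    Complex.dist_eq]

theorem sub_conj_ne_zero (z a : ℍ) : (a : ℂ) - starRingEnd ℂ (z : ℂ) ≠ 0 := fun h => by
  have him : a.im + z.im = 0 := by simpa using congrArg Complex.im h
  linarith [a.im_pos, z.im_pos]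

theorem one_sub_norm_diskCoord_sq (z a : ℍ) : 1 - ‖diskCoord z a‖ ^ 2 =
    4 * a.im * z.im / ‖(a : ℂ) - starRingEnd ℂ (z : ℂ)‖ ^ 2 := by
  have h := norm_ne_zero_iff.2 (sub_conj_ne_zero z a)
  rw [diskCoord, norm_div, div_pow, eq_div_iff (pow_ne_zero 2 h), sub_mul,
    div_mul_cancel₀ _ (pow_ne_zero 2 h), Complex.sq_norm, Complex.sq_norm, Complex.normSq_apply,
    Complex.normSq_apply]
  simp only [Complex.sub_re, Complex.sub_im, Complex.conj_re, Complex.conj_im,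
    UpperHalfPlane.coe_re, UpperHalfPlane.coe_im]
  ring

theorem one_sub_norm_diskCoord_sq_pos (z a : ℍ) : 0 < 1 - ‖diskCoord z a‖ ^ 2 := by
  have h := norm_pos_iff.2 (sub_conj_ne_zero z a)
  have := a.im_pos
  have := z.im_pos
  rw [one_sub_norm_diskCoord_sq]
  positivity

theorem norm_diskCoord_sub (z a b : ℍ) : ‖diskCoord z a - diskCoord z b‖ =
    dist (a : ℂ) b * (2 * z.im) /
      (‖(a : ℂ) - starRingEnd ℂ (z : ℂ)‖ * ‖(b : ℂ) - starRingEnd ℂ (z : ℂ)‖) := by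
  have hz : ‖(z : ℂ) - starRingEnd ℂ (z : ℂ)‖ = 2 * z.im := by
    rw [Complex.sub_conj, norm_mul, Complex.norm_I, mul_one, Complex.norm_real, Real.norm_eq_abs,
      UpperHalfPlane.coe_im, abs_of_pos (mul_pos two_pos z.im_pos)]
  rw [Complex.dist_eq, ← hz, ← norm_mul, ← norm_mul, ← norm_div, diskCoord, diskCoord,
    div_sub_div _ _ (sub_conj_ne_zero z a) (sub_conj_ne_zero z b)]
  congr 2
  ring

theorem cosh_dist_eq_diskCoord (z a b : ℍ) : Real.cosh (dist a b) =
    1 + 2 * ‖diskCoord z a - diskCoord z b‖ ^ 2 /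
      ((1 - ‖diskCoord z a‖ ^ 2) * (1 - ‖diskCoord z b‖ ^ 2)) := by
  have ha := norm_ne_zero_iff.2 (sub_conj_ne_zero z a)
  have hb := norm_ne_zero_iff.2 (sub_conj_ne_zero z b)
  have := a.im_pos
  have := b.im_pos
  have := z.im_pos
  rw [UpperHalfPlane.cosh_dist, norm_diskCoord_sub, one_sub_norm_diskCoord_sq,
    one_sub_norm_diskCoord_sq]
  field_simp
  ring

theorem cosh_dist_mul (z a : ℍ) :
    Real.cosh (dist z a) * (1 - ‖diskCoord z a‖ ^ 2) = 1 + ‖diskCoord z a‖ ^ 2 := by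
  have h : dist z a = 2 * (dist z a / 2) := by ring
  rw [norm_diskCoord, h, Real.cosh_two_mul, ← h, Real.tanh_eq_sinh_div_cosh]
  field_simp [(Real.cosh_pos (dist z a / 2)).ne']
  rw [Real.cosh_sq]
  ring

theorem sinh_dist_mul (z a : ℍ) :
    Real.sinh (dist z a) * (1 - ‖diskCoord z a‖ ^ 2) = 2 * ‖diskCoord z a‖ := by
  have h : dist z a = 2 * (dist z a / 2) := by ring
  rw [norm_diskCoord, h, Real.sinh_two_mul, ← h, Real.tanh_eq_sinh_div_cosh]
  field_simp [(Real.cosh_pos (dist z a / 2)).ne']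
  rw [Real.cosh_sq]
  ring

theorem law_of_cosines (a z b : ℍ) :
    Real.cos (angle a z b) * (Real.sinh (dist z a) * Real.sinh (dist z b)) =
      Real.cosh (dist z a) * Real.cosh (dist z b) - Real.cosh (dist a b) := by
  have hinner := InnerProductGeometry.cos_angle_mul_norm_mul_norm (diskCoord z a) (diskCoord z b)
  have hpolar := norm_sub_sq_real (diskCoord z a) (diskCoord z b)
  have ha := one_sub_norm_diskCoord_sq_pos z a
  have hb := one_sub_norm_diskCoord_sq_pos z b
  rw [cosh_dist_eq_diskCoord z a b, hpolar, ← hinner, ← angle,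
    eq_div_of_mul_eq ha.ne' (cosh_dist_mul z a), eq_div_of_mul_eq hb.ne' (cosh_dist_mul z b),
    eq_div_of_mul_eq ha.ne' (sinh_dist_mul z a), eq_div_of_mul_eq hb.ne' (sinh_dist_mul z b)]
  field_simp
  ring

theorem eq_pi_div_two_sub_arctan {θ h p q : ℝ} (hθ : θ ∈ Set.Icc 0 Real.pi) (hh : 0 < h)
    (hq : 0 < q) (hcos : Real.cos θ * h = p) (hpq : h ^ 2 = p ^ 2 + q ^ 2) :
    θ = Real.pi / 2 - Real.arctan (p / q) := by
  have hsin : Real.sin θ * h = q := by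
    rw [← sq_eq_sq₀ (mul_nonneg (Real.sin_nonneg_of_mem_Icc hθ) hh.le) hq.le, mul_pow,
      Real.sin_sq, sub_mul, ← mul_pow, hcos]
    linarith
  have hsin₀ : Real.sin θ ≠ 0 := left_ne_zero_of_mul (hsin ▸ hq.ne')
  have h₀ : 0 < θ := hθ.1.lt_of_ne fun h => hsin₀ (h ▸ Real.sin_zero)
  have hπ : θ < Real.pi := hθ.2.lt_of_ne fun h => hsin₀ (h ▸ Real.sin_pi)
  have htan : Real.tan (Real.pi / 2 - θ) = p / q := by
    rw [Real.tan_pi_div_two_sub, Real.tan_eq_sin_div_cos, inv_div, ← hcos, ← hsin,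
      mul_div_mul_right _ _ hh.ne']
  rw [← htan, Real.arctan_tan (by linarith) (by linarith), sub_sub_cancel]

/-- The angle, at the end of the rib of length `r`, of the quadrilateral with base `l` and ribs `r`
and `r'`. -/
def cornerAngle (l r r' : ℝ) : ℝ :=
  Real.pi / 2 -
    Real.arctan ((Real.sinh r * Real.cosh l - Real.cosh r * Real.tanh r') / Real.sinh l)

theorem angle_fermi {t t' r l : ℝ} (hl : 0 < l) (ht : |t - t'| = l) (hr : 0 < r) (r' : ℝ) :
    angle (fermi t 0) (fermi t r) (fermi t' r') = cornerAngle l r r' := by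
  have hrib : dist (fermi t r) (fermi t 0) = r := by
    rw [dist_of_proj_eq (by rw [proj_fermi, proj_fermi]), height_fermi, height_fermi, sub_zero,
      abs_of_pos hr]
  have hside : 0 < dist (fermi t r) (fermi t' r') := by
    refine hl.trans_le ?_
    simpa only [proj_fermi, ht] using abs_proj_sub_le_dist (fermi t r) (fermi t' r')
  have hcosh : Real.cosh (t - t') = Real.cosh l := by rw [← ht, Real.cosh_abs]
  have hcosh_side := cosh_dist (fermi t r) (fermi t' r')
  have hcosh_diag := cosh_dist (fermi t 0) (fermi t' r')
  simp only [proj_fermi, height_fermi, hcosh, Real.cosh_zero, Real.sinh_zero, one_mul, zero_mul,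
    sub_zero] at hcosh_side hcosh_diag
  have hcosines := law_of_cosines (fermi t 0) (fermi t r) (fermi t' r')
  rw [hrib, hcosh_diag, hcosh_side] at hcosines
  have hcot : (Real.sinh r * Real.cosh l - Real.cosh r * Real.tanh r') / Real.sinh l =
      (Real.sinh r * Real.cosh r' * Real.cosh l - Real.cosh r * Real.sinh r') /
        (Real.cosh r' * Real.sinh l) := by
    have := Real.cosh_pos r'
    rw [Real.tanh_eq_sinh_div_cosh]
    field_simp
  rw [cornerAngle, hcot]
  refine eq_pi_div_two_sub_arctan
    ⟨InnerProductGeometry.angle_nonneg _ _, InnerProductGeometry.angle_le_pi _ _⟩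
    (Real.sinh_pos_iff.2 hside) (mul_pos (Real.cosh_pos r') (Real.sinh_pos_iff.2 hl))
    (mul_left_cancel₀ (Real.sinh_pos_iff.2 hr).ne' ?_) ?_
  · linear_combination hcosines + Real.cosh r' * Real.cosh l * Real.cosh_sq r
  · rw [Real.sinh_sq, hcosh_side]
    linear_combination (Real.cosh r' ^ 2 * Real.cosh l ^ 2 - Real.sinh r' ^ 2) * Real.cosh_sq r +
      Real.cosh_sq r' + Real.cosh r' ^ 2 * Real.cosh_sq l

theorem cornerAngle_self {l : ℝ} (hl : 0 < l) (r : ℝ) :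
    cornerAngle l r r = Real.pi / 2 - Real.arctan (Real.sinh r * Real.tanh (l / 2)) := by
  have hl₂ : l = 2 * (l / 2) := by ring
  rw [cornerAngle, hl₂, Real.sinh_two_mul, Real.cosh_two_mul, Real.cosh_sq, ← hl₂,
    Real.tanh_eq_sinh_div_cosh, Real.tanh_eq_sinh_div_cosh]
  congr 2
  field_simp [(Real.sinh_pos_iff.2 (half_pos hl)).ne']
  ring

theorem tanh_monotone : Monotone Real.tanh := fun r s h => by
  rw [Real.tanh_eq_sinh_div_cosh, Real.tanh_eq_sinh_div_cosh,
    div_le_div_iff₀ (Real.cosh_pos _) (Real.cosh_pos _)]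
  have hsinh := Real.sinh_nonneg_iff.2 (sub_nonneg.2 h)
  rw [Real.sinh_sub] at hsinh
  linarith

theorem tanh_pos {r : ℝ} (hr : 0 < r) : 0 < Real.tanh r := by
  rw [Real.tanh_eq_sinh_div_cosh]
  exact div_pos (Real.sinh_pos_iff.2 hr) (Real.cosh_pos r)

theorem monotone_cornerAngle {l : ℝ} (hl : 0 < l) (r : ℝ) : Monotone (cornerAngle l r) :=
  fun _ _ h => sub_le_sub_left (Real.arctan_strictMono.monotone
    (div_le_div_of_nonneg_right (sub_le_sub_left
      (mul_le_mul_of_nonneg_left (tanh_monotone h) (Real.cosh_pos r).le) _)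
    (Real.sinh_pos_iff.2 hl).le)) _

theorem continuous_cornerAngle (l : ℝ) :
    Continuous fun r : ℝ × ℝ => cornerAngle l r.1 r.2 := by
  have htanh : Continuous Real.tanh := by
    simp only [funext Real.tanh_eq_sinh_div_cosh]
    exact Real.continuous_sinh.div Real.continuous_cosh fun x => (Real.cosh_pos x).ne'
  unfold cornerAngle
  fun_prop

/-- The Gudermannian function. In terms of it the corner angle of a quadrilateral decreases when
the adjacent rib grows by at least as much as the opposite one, see `cornerAngle_lt`. -/
def gudermannian (r : ℝ) : ℝ := Real.arctan (Real.sinh r)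

theorem strictMono_gudermannian : StrictMono gudermannian :=
  Real.arctan_strictMono.comp Real.sinh_strictMono

theorem gudermannian_nonneg {r : ℝ} (hr : 0 ≤ r) : 0 ≤ gudermannian r :=
  Real.arctan_nonneg.2 (Real.sinh_nonneg_iff.2 hr)

theorem gudermannian_lt_pi_div_two (r : ℝ) : gudermannian r < Real.pi / 2 :=
  Real.arctan_lt_pi_div_two _

theorem sin_gudermannian (r : ℝ) : Real.sin (gudermannian r) = Real.tanh r := by
  rw [gudermannian, Real.sin_arctan, Real.tanh_eq_sinh_div_cosh, ← Real.cosh_sq',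
    Real.sqrt_sq (Real.cosh_pos r).le]

theorem cos_gudermannian (r : ℝ) : Real.cos (gudermannian r) = 1 / Real.cosh r := by
  rw [gudermannian, Real.cos_arctan, ← Real.cosh_sq', Real.sqrt_sq (Real.cosh_pos r).le]

theorem sin_mul_cos_sub_le_sin {u w m t : ℝ} (hu : 0 ≤ u) (hum : u + m ≤ Real.pi / 2)
    (hw : w ≤ Real.pi / 2) (hm : 0 ≤ m) (ht : 0 ≤ t) (htwm : t ≤ w + m) :
    Real.sin t * Real.cos u - Real.sin w * Real.cos (u + m) ≤ Real.sin m := by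
  have hπ := Real.pi_pos
  have hsin_m : 0 ≤ Real.sin m := Real.sin_nonneg_of_nonneg_of_le_pi hm (by linarith)
  have hcos_u : 0 ≤ Real.cos u := Real.cos_nonneg_of_mem_Icc ⟨by linarith, by linarith⟩
  rcases le_total (w + m) (Real.pi / 2) with h | h
  · have hsin : Real.sin t ≤ Real.sin (w + m) :=
      Real.sin_le_sin_of_le_of_le_pi_div_two (by linarith) h htwm
    calc Real.sin t * Real.cos u - Real.sin w * Real.cos (u + m)
        ≤ Real.sin (w + m) * Real.cos u - Real.sin w * Real.cos (u + m) := by gcongr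
      _ = Real.sin m * Real.cos (w - u) := by
          rw [Real.sin_add, Real.cos_add, Real.cos_sub]
          ring
      _ ≤ Real.sin m := mul_le_of_le_one_right hsin_m (Real.cos_le_one _)
  · have hcos_m : Real.cos m ≤ Real.sin w := by
      rw [← Real.cos_pi_div_two_sub]
      exact Real.cos_le_cos_of_nonneg_of_le_pi (by linarith) (by linarith) (by linarith)
    have hcos_um : 0 ≤ Real.cos (u + m) := Real.cos_nonneg_of_mem_Icc ⟨by linarith, by linarith⟩
    calc Real.sin t * Real.cos u - Real.sin w * Real.cos (u + m)
        ≤ 1 * Real.cos u - Real.cos m * Real.cos (u + m) := by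
          gcongr
          exact Real.sin_le_one t
      _ = Real.sin (u + m) * Real.sin m := by
          rw [show u = u + m - m by ring, Real.cos_sub, sub_add_cancel]
          ring
      _ ≤ Real.sin m := mul_le_of_le_one_left hsin_m (Real.sin_le_one _)

theorem cornerAngle_lt {l r₁ r₂ s₁ s₂ : ℝ} (hl : 0 < l) (hr₁ : 0 ≤ r₁) (hs₂ : 0 ≤ s₂)
    (hr : r₁ < r₂)
    (h : gudermannian s₂ - gudermannian s₁ ≤ gudermannian r₂ - gudermannian r₁) :
    cornerAngle l r₂ s₂ < cornerAngle l r₁ s₁ := by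
  have hgd := strictMono_gudermannian hr
  have hsin := sin_mul_cos_sub_le_sin (gudermannian_nonneg hr₁)
    ((add_sub_cancel _ _).trans_le (gudermannian_lt_pi_div_two r₂).le)
    (gudermannian_lt_pi_div_two s₁).le (sub_pos.2 hgd).le (gudermannian_nonneg hs₂)
    (sub_le_iff_le_add'.1 h)
  rw [add_sub_cancel, Real.sin_sub, sin_gudermannian, sin_gudermannian, sin_gudermannian,
    sin_gudermannian, cos_gudermannian, cos_gudermannian, Real.tanh_eq_sinh_div_cosh r₁,
    Real.tanh_eq_sinh_div_cosh r₂] at hsin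
  have hcosh₁ := Real.cosh_pos r₁
  have hcosh₂ := Real.cosh_pos r₂
  have hright : Real.sinh r₁ - Real.cosh r₁ * Real.tanh s₁ ≤
      Real.sinh r₂ - Real.cosh r₂ * Real.tanh s₂ := by
    have := mul_le_mul_of_nonneg_right hsin (mul_pos hcosh₁ hcosh₂).le
    field_simp at this
    linarith
  have hgrow : Real.sinh r₁ * (Real.cosh l - 1) < Real.sinh r₂ * (Real.cosh l - 1) :=
    mul_lt_mul_of_pos_right (Real.sinh_lt_sinh.2 hr) (sub_pos.2 (Real.one_lt_cosh.2 hl.ne'))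
  exact sub_lt_sub_left (Real.arctan_strictMono
    (div_lt_div_of_pos_right (by linarith) (Real.sinh_pos_iff.2 hl))) _

end Hyp

/-! ## Existence and uniqueness of the rib lengths -/

/-- Perron's method: a subsolution of a quasimonotone system lies below a solution, if the
subsolutions above it are bounded. -/
theorem exists_eq_of_subsolution {V : Type*} [Finite V] {F : (V → ℝ) → V → ℝ} {c R θ : V → ℝ}
    (hF : ∀ v, Continuous fun ρ => F ρ v)
    (hmono : ∀ ⦃ρ ρ' v⦄, ρ ≤ ρ' → ρ v = ρ' v → F ρ v ≤ F ρ' v)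
    (hc : θ ≤ F c) (hbound : ∀ ρ, c ≤ ρ → θ ≤ F ρ → ρ ≤ R) : ∃ ρ, c ≤ ρ ∧ F ρ = θ := by
  classical
  have := Fintype.ofFinite V
  have hcompact : IsCompact (Set.Icc c R ∩ ⋂ v, {ρ | θ v ≤ F ρ v}) :=
    isCompact_Icc.inter_right (isClosed_iInter fun v => isClosed_le continuous_const (hF v))
  have hmem : ∀ ρ, c ≤ ρ → θ ≤ F ρ → ρ ∈ Set.Icc c R ∩ ⋂ v, {ρ | θ v ≤ F ρ v} :=
    fun ρ hcρ hρ => ⟨⟨hcρ, hbound ρ hcρ hρ⟩, Set.mem_iInter.2 hρ⟩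
  obtain ⟨ρ, hρ, hmax⟩ := hcompact.exists_isMaxOn ⟨c, hmem c le_rfl hc⟩
    (f := fun ρ => ∑ v, ρ v) (by fun_prop)
  have hθ : θ ≤ F ρ := Set.mem_iInter.1 hρ.2
  refine ⟨ρ, hρ.1.1, funext fun v => le_antisymm (not_lt.1 fun hlt => ?_) (hθ v)⟩
  have hcont : Continuous fun s => F (Function.update ρ v s) v :=
    (hF v).comp (continuous_const.update v continuous_id)
  have hev : ∀ᶠ s in 𝓝[>] ρ v, θ v < F (Function.update ρ v s) v :=
    ((hcont.tendsto (ρ v)).eventually_const_lt (by simpa using hlt)).filter_mono nhdsWithin_le_nhds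
  obtain ⟨s, hs, hρs⟩ := (hev.and self_mem_nhdsWithin).exists
  have hρs : ρ v < s := hρs
  have hle : ρ ≤ Function.update ρ v s := le_update_self_iff.2 hρs.le
  have hsub : θ ≤ F (Function.update ρ v s) := fun w => by
    rcases eq_or_ne w v with rfl | hw
    · exact hs.le
    · exact (hθ w).trans (hmono hle (Function.update_of_ne hw _ _).symm)
  have hsum : ∑ w, Function.update ρ v s w ≤ ∑ w, ρ w := hmax (hmem _ (hρ.1.1.trans hle) hsub)
  exact hsum.not_gt (Finset.sum_lt_sum (fun w _ => hle w)
    ⟨v, Finset.mem_univ v, by rwa [Function.update_self]⟩)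

namespace MetricRibbonGraph

variable {X : Type*} {n : ℕ} (G : MetricRibbonGraph X n)

theorem exists_head_eq (v : G.Vertex) : ∃ x, G.head x = v := Quotient.exists_rep v

instance [Finite X] : Finite G.Vertex := inferInstanceAs (Finite (Quotient _))

theorem headAngle_eq {ρ : G.Vertex → ℝ} (hρ : ∀ v, 0 < ρ v) (x : X) :
    G.headAngle ρ x = Hyp.cornerAngle (G.len x) (ρ (G.head x)) (ρ (G.tail x)) :=
  Hyp.angle_fermi (G.len_pos x) (by rw [sub_zero, abs_of_pos (G.len_pos x)]) (hρ _) _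

theorem tailAngle_eq {ρ : G.Vertex → ℝ} (hρ : ∀ v, 0 < ρ v) (x : X) :
    G.tailAngle ρ x = Hyp.cornerAngle (G.len x) (ρ (G.tail x)) (ρ (G.head x)) :=
  Hyp.angle_fermi (G.len_pos x) (by rw [zero_sub, abs_neg, abs_of_pos (G.len_pos x)]) (hρ _) _

section Fintype

variable [Fintype X]

open Classical in
/-- Half of the total angle at the vertex `v`: an edge pointing toward `v` has two congruent
corners there, one on either side. -/
def halfAngle (ρ : G.Vertex → ℝ) (v : G.Vertex) : ℝ :=
  ∑ x ∈ Finset.univ.filter (fun x => G.head x = v),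
    Hyp.cornerAngle (G.len x) (ρ v) (ρ (G.tail x))

theorem isRibLengths_iff (ρ : G.Vertex → ℝ) :
    G.IsRibLengths ρ ↔ (∀ v, 0 < ρ v) ∧ ∀ v, G.halfAngle ρ v = Real.pi := by
  classical
  refine and_congr_right fun hρ => forall_congr' fun v => ?_
  have hsum : ∑ x with G.head x = v, (G.headAngle ρ x + G.tailAngle ρ (G.s₁ x)) =
      2 * G.halfAngle ρ v := by
    rw [halfAngle, Finset.mul_sum]
    refine Finset.sum_congr rfl fun x hx => ?_
    rw [G.headAngle_eq hρ, G.tailAngle_eq hρ, G.len_s₁, G.tail_s₁, two_mul,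
      ← (Finset.mem_filter.1 hx).2]
    rfl
  rw [hsum, mul_right_inj' two_ne_zero]

theorem continuous_halfAngle (v : G.Vertex) : Continuous fun ρ => G.halfAngle ρ v := by
  unfold halfAngle
  refine continuous_finsetSum _ fun x _ => (Hyp.continuous_cornerAngle (G.len x)).comp
    (f := fun ρ : G.Vertex → ℝ => (ρ v, ρ (G.tail x))) ?_
  fun_prop

theorem halfAngle_mono ⦃ρ ρ' : G.Vertex → ℝ⦄ ⦃v : G.Vertex⦄ (h : ρ ≤ ρ') (hv : ρ v = ρ' v) :
    G.halfAngle ρ v ≤ G.halfAngle ρ' v := by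
  simp only [halfAngle, hv]
  exact Finset.sum_le_sum fun x _ => Hyp.monotone_cornerAngle (G.len_pos x) _ (h _)

theorem exists_pi_div_card_le_cornerAngle {ρ : G.Vertex → ℝ} {v : G.Vertex}
    (h : Real.pi ≤ G.halfAngle ρ v) : ∃ x, G.head x = v ∧
      Real.pi / Fintype.card X ≤ Hyp.cornerAngle (G.len x) (ρ v) (ρ (G.tail x)) := by
  classical
  obtain ⟨y, hy⟩ := G.exists_head_eq v
  have hcard : 0 < (Fintype.card X : ℝ) := Nat.cast_pos.2 (Fintype.card_pos_iff.2 ⟨y⟩)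
  have hsum : ∑ x with G.head x = v, Real.pi / Fintype.card X ≤ G.halfAngle ρ v := by
    refine le_trans ?_ h
    rw [Finset.sum_const, nsmul_eq_mul, ← mul_div_assoc, div_le_iff₀ hcard, mul_comm]
    gcongr
    exact Finset.card_le_univ _
  obtain ⟨x, hx, hle⟩ := Finset.exists_le_of_sum_le ⟨y, by simpa using hy⟩ hsum
  exact ⟨x, (Finset.mem_filter.1 hx).2, hle⟩

/-- At a vertex with the longest rib all corner angles are at most those of the symmetric
quadrilateral, so that a long rib makes the total angle small. -/
theorem sinh_mul_tanh_le {m : ℝ} (hm : 0 < m) (hlen : ∀ x, m ≤ G.len x)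
    {ρ : G.Vertex → ℝ} (hρ : ∀ v, 0 ≤ ρ v) (h : ∀ v, Real.pi ≤ G.halfAngle ρ v) (v : G.Vertex) :
    Real.sinh (ρ v) * Real.tanh (m / 2) ≤ Real.tan (Real.pi / 2 - Real.pi / Fintype.card X) := by
  have : Nonempty G.Vertex := ⟨v⟩
  obtain ⟨w, hw⟩ := Finite.exists_max ρ
  obtain ⟨x, -, hx⟩ := G.exists_pi_div_card_le_cornerAngle (h w)
  have hangle := hx.trans (Hyp.monotone_cornerAngle (G.len_pos x) _ (hw (G.tail x)))
  rw [Hyp.cornerAngle_self (G.len_pos x)] at hangle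
  have hcard : (1 : ℝ) < Fintype.card X :=
    Nat.one_lt_cast.2 (Fintype.one_lt_card_iff.2 ⟨_, _, G.s₁_ne x⟩)
  have hpos : 0 < Real.pi / Fintype.card X := div_pos Real.pi_pos (one_pos.trans hcard)
  have hlt : Real.pi / Fintype.card X < Real.pi := div_lt_self Real.pi_pos hcard
  calc Real.sinh (ρ v) * Real.tanh (m / 2) ≤ Real.sinh (ρ w) * Real.tanh (G.len x / 2) :=
        mul_le_mul (Real.sinh_le_sinh.2 (hw v))
          (Hyp.tanh_monotone (div_le_div_of_nonneg_right (hlen x) zero_le_two))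
          (Hyp.tanh_pos (half_pos hm)).le (Real.sinh_nonneg_iff.2 (hρ w))
    _ ≤ Real.tan (Real.pi / 2 - Real.pi / Fintype.card X) := by
        rw [← Real.arctan_le_arctan_iff, Real.arctan_tan (by linarith) (by linarith)]
        linarith

variable (X n) in
theorem exists_forall_rib_le {m : ℝ} (hm : 0 < m) :
    ∃ R, ∀ G : MetricRibbonGraph X n, (∀ x, m ≤ G.len x) → ∀ ρ : G.Vertex → ℝ, (∀ v, 0 ≤ ρ v) →
      (∀ v, Real.pi ≤ G.halfAngle ρ v) → ∀ v, ρ v ≤ R := by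
  refine ⟨Real.arsinh (Real.tan (Real.pi / 2 - Real.pi / Fintype.card X) / Real.tanh (m / 2)),
    fun G hlen ρ hρ h v => ?_⟩
  rw [← Real.sinh_le_sinh, Real.sinh_arsinh, le_div_iff₀ (Hyp.tanh_pos (half_pos hm))]
  exact G.sinh_mul_tanh_le hm hlen hρ h v

theorem three_le_card_head [DecidableEq G.Vertex] (v : G.Vertex) :
    3 ≤ (Finset.univ.filter fun x => G.head x = v).card := by
  classical
  obtain ⟨x, rfl⟩ := G.exists_head_eq v
  rw [← Finset.card_eq_three.2 ⟨x, G.s₀ x, G.s₀ (G.s₀ x), (G.s₀_ne x).symm, (G.s₀_s₀_ne x).symm,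
    (G.s₀_ne _).symm, rfl⟩]
  refine Finset.card_le_card fun y hy => ?_
  simp only [Finset.mem_insert, Finset.mem_singleton] at hy
  rcases hy with rfl | rfl | rfl <;> simp [RibbonGraph.head_s₀]

/-- For `sinh r = tan (π / 6)` the corner angles of symmetric quadrilaterals exceed `π / 3`, and
there are at least three edges at each vertex. -/
theorem pi_le_halfAngle_const (v : G.Vertex) :
    Real.pi ≤ G.halfAngle (fun _ => Real.arsinh (Real.tan (Real.pi / 6))) v := by
  classical
  have hπ := Real.pi_pos
  have htan : 0 ≤ Real.tan (Real.pi / 6) :=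
    Real.tan_nonneg_of_nonneg_of_le_pi_div_two (by linarith) (by linarith)
  have hangle : ∀ x, Real.pi / 3 ≤ Hyp.cornerAngle (G.len x)
      (Real.arsinh (Real.tan (Real.pi / 6))) (Real.arsinh (Real.tan (Real.pi / 6))) := by
    intro x
    have harctan := Real.arctan_strictMono.monotone
      (mul_le_of_le_one_right htan (Real.tanh_lt_one (G.len x / 2)).le)
    rw [Real.arctan_tan (by linarith) (by linarith)] at harctan
    rw [Hyp.cornerAngle_self (G.len_pos x), Real.sinh_arsinh]
    linarith
  calc Real.pi = 3 * (Real.pi / 3) := by ring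
    _ ≤ (Finset.univ.filter fun x => G.head x = v).card * (Real.pi / 3) := by
        gcongr
        exact_mod_cast G.three_le_card_head v
    _ ≤ _ := by
        rw [← nsmul_eq_mul]
        exact Finset.card_nsmul_le_sum _ _ _ fun x _ => hangle x

theorem exists_isRibLengths [Nonempty X] : ∃ ρ, G.IsRibLengths ρ := by
  obtain ⟨x, hx⟩ := Finite.exists_min G.len
  obtain ⟨R, hR⟩ := exists_forall_rib_le X n (G.len_pos x)
  have hπ := Real.pi_pos
  have hc : 0 < Real.arsinh (Real.tan (Real.pi / 6)) :=
    Real.arsinh_pos_iff.2 (Real.tan_pos_of_pos_of_lt_pi_div_two (by linarith) (by linarith))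
  obtain ⟨ρ, hcρ, hρ⟩ := exists_eq_of_subsolution (F := G.halfAngle) (R := fun _ => R)
    G.continuous_halfAngle G.halfAngle_mono G.pi_le_halfAngle_const
    fun ρ hcρ hρ => hR G hx ρ (fun v => hc.le.trans (hcρ v)) hρ
  exact ⟨ρ, (G.isRibLengths_iff ρ).2 ⟨fun v => hc.trans_le (hcρ v), congrFun hρ⟩⟩

variable {G}

theorem IsRibLengths.le {ρ ρ' : G.Vertex → ℝ} (h : G.IsRibLengths ρ) (h' : G.IsRibLengths ρ') :
    ρ' ≤ ρ := by
  -- Where the difference of the Gudermannians is largest, the angle of `ρ'` would be too small.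
  intro v
  have : Nonempty G.Vertex := ⟨v⟩
  obtain ⟨hpos, hangle⟩ := (G.isRibLengths_iff ρ).1 h
  obtain ⟨hpos', hangle'⟩ := (G.isRibLengths_iff ρ').1 h'
  obtain ⟨w, hw⟩ := Finite.exists_max fun v =>
    Hyp.gudermannian (ρ' v) - Hyp.gudermannian (ρ v)
  suffices hle : ρ' w ≤ ρ w by
    have := Hyp.strictMono_gudermannian.monotone hle
    exact Hyp.strictMono_gudermannian.le_iff_le.1 (by linarith [hw v])
  by_contra! hlt
  obtain ⟨y, hy⟩ := G.exists_head_eq w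
  have hlt_angle : G.halfAngle ρ' w < G.halfAngle ρ w :=
    Finset.sum_lt_sum_of_nonempty ⟨y, by simpa using hy⟩ fun x _ =>
      Hyp.cornerAngle_lt (G.len_pos x) (hpos w).le (hpos' _).le hlt (hw _)
  rw [hangle, hangle'] at hlt_angle
  exact lt_irrefl _ hlt_angle

variable (G)

theorem existsUnique_isRibLengths [Nonempty X] : ∃! ρ, G.IsRibLengths ρ :=
  existsUnique_of_exists_of_unique G.exists_isRibLengths fun _ _ h h' =>
    le_antisymm (h'.le h) (h.le h')

theorem isRibLengths_ribLengths [Nonempty X] : G.IsRibLengths G.ribLengths :=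
  Classical.epsilon_spec G.exists_isRibLengths

variable (X n) in
theorem exists_forall_ribLengths_mem_Icc [Nonempty X] {m : ℝ} (hm : 0 < m) :
    ∃ R, ∀ G : MetricRibbonGraph X n, (∀ x, m ≤ G.len x) → ∀ v, G.ribLengths v ∈ Set.Icc 0 R := by
  obtain ⟨R, hR⟩ := exists_forall_rib_le X n hm
  refine ⟨R, fun G hlen v => ?_⟩
  obtain ⟨hpos, hangle⟩ := (G.isRibLengths_iff _).1 G.isRibLengths_ribLengths
  exact ⟨(hpos v).le, hR G hlen _ (fun v => (hpos v).le) (fun v => (hangle v).ge) v⟩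

end Fintype

end MetricRibbonGraph

/-! ## The surface and its spine -/

namespace Hyp

section Quadrilateral

variable {l r r' R : ℝ}

/-- The affine parametrisation, by the base, of the side opposite to the base of a quadrilateral. -/
def sidePoint (l r r' a : ℝ) : ℍ :=
  geodesic (fermi 0 r) (fermi l r') (a / l * dist (fermi 0 r) (fermi l r'))

theorem div_mul_dist_mem_Icc {a : ℝ} (ha : a ∈ Set.Icc 0 l) (A B : ℍ) :
    a / l * dist A B ∈ Set.Icc 0 (dist A B) :=
  ⟨mul_nonneg (div_nonneg ha.1 (ha.1.trans ha.2)) dist_nonneg,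
    mul_le_of_le_one_left dist_nonneg (div_le_one_of_le₀ ha.2 (ha.1.trans ha.2))⟩

theorem sidePoint_mem_side (r r' : ℝ) {a : ℝ} (ha : a ∈ Set.Icc 0 l) :
    sidePoint l r r' a ∈ seg (fermi 0 r) (fermi l r') :=
  geodesic_mem_seg (div_mul_dist_mem_Icc ha _ _)

theorem sidePoint_right (hl : l ≠ 0) (r r' : ℝ) : sidePoint l r r' l = fermi l r' := by
  rw [sidePoint, div_self hl, one_mul, geodesic_dist]

theorem dist_left_sidePoint (r r' : ℝ) {a : ℝ} (ha : a ∈ Set.Icc 0 l) :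
    dist (fermi 0 r) (sidePoint l r r' a) = a / l * dist (fermi 0 r) (fermi l r') :=
  dist_left_geodesic (div_mul_dist_mem_Icc ha _ _)

theorem dist_sidePoint_right (r r' : ℝ) {a : ℝ} (ha : a ∈ Set.Icc 0 l) :
    dist (sidePoint l r r' a) (fermi l r') =
      dist (fermi 0 r) (fermi l r') - a / l * dist (fermi 0 r) (fermi l r') :=
  dist_geodesic_right (div_mul_dist_mem_Icc ha _ _)

theorem dist_sidePoint (r r' : ℝ) {a b : ℝ} (ha : a ∈ Set.Icc 0 l) (hb : b ∈ Set.Icc 0 l) :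
    dist (sidePoint l r r' a) (sidePoint l r r' b) =
      dist (fermi 0 r) (fermi l r') / l * |a - b| := by
  rw [sidePoint, sidePoint, dist_geodesic (div_mul_dist_mem_Icc ha _ _)
    (div_mul_dist_mem_Icc hb _ _), ← sub_mul, ← sub_div, abs_mul, abs_div,
    abs_of_nonneg dist_nonneg, abs_of_nonneg (ha.1.trans ha.2)]
  ring

theorem dist_left_sub_proj_mem_Icc (hl : 0 ≤ l) (hr : r ∈ Set.Icc 0 R) (hr' : r' ∈ Set.Icc 0 R)
    {y : ℍ} (hy : y ∈ seg (fermi 0 r) (fermi l r')) :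
    dist (fermi 0 r) y - proj y ∈ Set.Icc 0 (2 * R) := by
  have hle := abs_proj_sub_le_dist (fermi 0 r) y
  have hge := dist_le_height_add_proj_add_height (fermi 0 r) y
  have hproj := (proj_mem_Icc_of_mem_side hl hy).1
  have hheight := abs_height_le_of_mem_side hr hr' hy
  rw [proj_fermi, zero_sub, abs_neg, abs_of_nonneg hproj] at hle hge
  rw [height_fermi, abs_of_nonneg hr.1] at hge
  constructor <;> linarith [hr.2]

theorem dist_corners_mem_Icc (hl : 0 ≤ l) (hr : r ∈ Set.Icc 0 R) (hr' : r' ∈ Set.Icc 0 R) :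
    dist (fermi 0 r) (fermi l r') ∈ Set.Icc l (l + 2 * R) := by
  have h := dist_left_sub_proj_mem_Icc hl hr hr' (right_mem_seg _ _)
  rw [proj_fermi] at h
  exact ⟨sub_nonneg.1 h.1, sub_le_iff_le_add'.1 h.2⟩

theorem dist_left_sidePoint_sub_mem_Icc (hr : r ∈ Set.Icc 0 R) (hr' : r' ∈ Set.Icc 0 R) {a : ℝ}
    (ha : a ∈ Set.Icc 0 l) : dist (fermi 0 r) (sidePoint l r r' a) - a ∈ Set.Icc 0 (2 * R) := by
  rcases (ha.1.trans ha.2).eq_or_lt with rfl | hl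
  · rw [dist_left_sidePoint r r' ha, div_zero, zero_mul, le_antisymm ha.2 ha.1]
    simpa using hr.1.trans hr.2
  · obtain ⟨hle, hge⟩ := dist_corners_mem_Icc hl.le hr hr'
    have heq : a / l * dist (fermi 0 r) (fermi l r') - a =
        a / l * (dist (fermi 0 r) (fermi l r') - l) := by
      field_simp
    rw [dist_left_sidePoint r r' ha, heq]
    exact ⟨mul_nonneg (div_nonneg ha.1 hl.le) (sub_nonneg.2 hle),
      (mul_le_of_le_one_left (sub_nonneg.2 hle) (div_le_one_of_le₀ ha.2 hl.le)).trans
        (sub_le_iff_le_add'.2 hge)⟩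

theorem abs_proj_sidePoint_sub_le (hr : r ∈ Set.Icc 0 R) (hr' : r' ∈ Set.Icc 0 R) {a : ℝ}
    (ha : a ∈ Set.Icc 0 l) : |proj (sidePoint l r r' a) - a| ≤ 2 * R := by
  have hproj := dist_left_sub_proj_mem_Icc (ha.1.trans ha.2) hr hr' (sidePoint_mem_side r r' ha)
  have hparam := dist_left_sidePoint_sub_mem_Icc hr hr' ha
  exact abs_le.2 ⟨by linarith [hproj.2, hparam.1], by linarith [hproj.1, hparam.2]⟩

theorem dist_sidePoint_proj_le (hl : 0 ≤ l) (hr : r ∈ Set.Icc 0 R) (hr' : r' ∈ Set.Icc 0 R) {z : ℍ}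
    (hz : z ∈ quad l r r') : dist (sidePoint l r r' (proj z)) z ≤ 3 * R := by
  obtain ⟨y, hy, hzy, hdist⟩ := exists_mem_side_of_mem_quad hr hr' hz
  have hmem := proj_mem_Icc_of_mem_side hl hy
  have hparam := dist_left_sidePoint_sub_mem_Icc hr hr' hmem
  have hproj := dist_left_sub_proj_mem_Icc hl hr hr' hy
  have hside : dist (sidePoint l r r' (proj y)) y ≤ 2 * R := by
    have hgeo := dist_geodesic (div_mul_dist_mem_Icc hmem (fermi 0 r) (fermi l r'))
      (dist_mem_Icc_of_mem_seg hy)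
    rw [geodesic_dist_left hy] at hgeo
    rw [dist_left_sidePoint r r' hmem] at hparam
    rw [sidePoint, hgeo]
    exact abs_le.2 ⟨by linarith [hproj.2, hparam.1], by linarith [hproj.1, hparam.2]⟩
  rw [hzy]
  linarith [dist_triangle_right (sidePoint l r r' (proj y)) z y]

end Quadrilateral

end Hyp

namespace GluingData

variable {ι Y : Type*} [PseudoEMetricSpace Y] (D : GluingData ι Y)

/-- The point of the glued space represented by a point of a piece. -/
def toSpace : D.Point → D.Space := SeparationQuotient.mk

theorem surjective_toSpace : Function.Surjective D.toSpace := SeparationQuotient.surjective_mk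

theorem toSpace_eq_of_glue {p q : D.Point} (h : D.glue p.idx p.pt q.idx q.pt) :
    D.toSpace p = D.toSpace q :=
  SeparationQuotient.mk_eq_mk.2 (EMetric.inseparable_iff.2 (D.edist_eq_zero_of_glue h))

theorem exists_lipschitzWith_lift {Z : Type*} [EMetricSpace Z] {f : D.Point → Z} {K : NNReal}
    (hK : K ≠ 0) (hglue : ∀ p q, D.glue p.idx p.pt q.idx q.pt → f p = f q)
    (hpiece : ∀ p q, p.idx = q.idx → edist (f p) (f q) ≤ K * edist p.pt q.pt) :
    ∃ F : D.Space → Z, LipschitzWith K F ∧ ∀ p, F (D.toSpace p) = f p := by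
  have hK₀ : (K : ℝ≥0∞) ≠ 0 := ENNReal.coe_ne_zero.2 hK
  have hstep : ∀ p q, edist (f p) (f q) ≤ K * D.step p q := by
    intro p q
    unfold step
    split_ifs with hpq hidx
    · rw [hpq.elim (hglue p q) fun h => (hglue q p h).symm, edist_self]
      exact zero_le
    · exact hpiece p q hidx
    · rw [ENNReal.mul_top hK₀]
      exact le_top
  have hchain : ∀ (c : List D.Point) (p q), edist (f p) (f q) ≤ K * D.chainLength p c q := by
    intro c
    induction c with
    | nil => exact hstep
    | cons a c ih =>
      intro p q
      rw [chainLength, mul_add]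
      exact (edist_triangle _ (f a) _).trans (add_le_add (hstep p a) (ih a q))
  have hf : LipschitzWith K f := fun p q => by
    change _ ≤ (K : ℝ≥0∞) * ⨅ c : List D.Point, D.chainLength p c q
    rw [ENNReal.mul_iInf_of_ne hK₀ ENNReal.coe_ne_top]
    exact le_iInf fun c => hchain c p q
  have hinsep : ∀ p q, Inseparable p q → f p = f q := fun p q h => (h.map hf.continuous).eq
  refine ⟨SeparationQuotient.lift f hinsep, fun u v => ?_, fun _ => rfl⟩
  obtain ⟨p, rfl⟩ := D.surjective_toSpace u
  obtain ⟨q, rfl⟩ := D.surjective_toSpace v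
  exact hf p q

end GluingData

theorem eq_of_sameCycle {α β : Type*} {σ : Equiv.Perm α} {f : α → β} (hf : ∀ x, f (σ x) = f x)
    {x y : α} (h : σ.SameCycle x y) : f x = f y := by
  obtain ⟨k, rfl⟩ := h
  induction k using Int.induction_on with
  | zero => rw [zpow_zero, Equiv.Perm.one_apply]
  | succ k ih => rw [add_comm, zpow_one_add, Equiv.Perm.mul_apply, hf, ih]
  | pred k ih =>
    rw [ih, ← hf ((σ ^ (-(k : ℤ) - 1)) x), ← Equiv.Perm.mul_apply, ← zpow_one_add,
      add_sub_cancel]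

theorem RibbonGraph.tail_s₂ {X : Type*} {n : ℕ} (G : RibbonGraph X n) (x : X) :
    G.tail (G.s₂ x) = G.head x := by
  rw [tail, s₂, Equiv.Perm.mul_apply, G.s₁_s₁, ← G.head_s₀]
  exact congrArg G.head (G.s₀.apply_symm_apply x)

namespace MetricRibbonGraph

variable {X : Type*} {n : ℕ} (G : MetricRibbonGraph X n)

/-- The point at distance `a` from the tail of the edge `x`. -/
def graphPoint (x : X) {a : ℝ} (ha : a ∈ Set.Icc 0 (G.len x)) : G.Graph :=
  G.graphGluing.toSpace ⟨x, a, ha⟩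

theorem exists_graphPoint_eq (u : G.Graph) :
    ∃ (x : X) (a : ℝ) (ha : a ∈ Set.Icc 0 (G.len x)), G.graphPoint x ha = u := by
  obtain ⟨⟨x, a, ha⟩, rfl⟩ := G.graphGluing.surjective_toSpace u
  exact ⟨x, a, ha, rfl⟩

theorem dist_graphPoint_le (x : X) {a b : ℝ} (ha : a ∈ Set.Icc 0 (G.len x))
    (hb : b ∈ Set.Icc 0 (G.len x)) : dist (G.graphPoint x ha) (G.graphPoint x hb) ≤ |a - b| := by
  rw [← Real.dist_eq, dist_edist, dist_edist a]
  exact ENNReal.toReal_mono (edist_ne_top _ _) (G.graphGluing.edist_le_of_piece ha hb)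

theorem graphPoint_s₁ (x : X) {a b : ℝ} (ha : a ∈ Set.Icc 0 (G.len x))
    (hb : b ∈ Set.Icc 0 (G.len (G.s₁ x))) (h : a + b = G.len x) :
    G.graphPoint x ha = G.graphPoint (G.s₁ x) hb :=
  G.graphGluing.toSpace_eq_of_glue (Or.inl ⟨rfl, h⟩)

theorem graphPoint_head_eq_tail {x y : X} (h : G.head x = G.tail y) {a b : ℝ}
    (ha : a ∈ Set.Icc 0 (G.len x)) (hb : b ∈ Set.Icc 0 (G.len y)) (ha₁ : a = G.len x)
    (hb₀ : b = 0) : G.graphPoint x ha = G.graphPoint y hb := by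
  rw [G.graphPoint_s₁ y hb (Set.right_mem_Icc.2 (G.len_pos _).le) (by rw [hb₀, zero_add, G.len_s₁])]
  exact G.graphGluing.toSpace_eq_of_glue (Or.inr ⟨h, ha₁, rfl⟩)

variable {ρ : G.Vertex → ℝ}

variable (ρ) in
/-- The point of the surface represented by a point of the quadrilateral of the edge `x`. -/
def surfacePoint (x : X) {z : ℍ} (hz : z ∈ G.piece ρ x) : G.GluedSurface ρ :=
  (G.surfaceGluing ρ).toSpace ⟨x, z, hz⟩

theorem exists_surfacePoint_eq (u : G.GluedSurface ρ) :
    ∃ (x : X) (z : ℍ) (hz : z ∈ G.piece ρ x), G.surfacePoint ρ x hz = u := by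
  obtain ⟨⟨x, z, hz⟩, rfl⟩ := (G.surfaceGluing ρ).surjective_toSpace u
  exact ⟨x, z, hz, rfl⟩

theorem dist_surfacePoint_le (x : X) {z w : ℍ} (hz : z ∈ G.piece ρ x) (hw : w ∈ G.piece ρ x) :
    dist (G.surfacePoint ρ x hz) (G.surfacePoint ρ x hw) ≤ dist z w := by
  rw [dist_edist, dist_edist z]
  exact ENNReal.toReal_mono (edist_ne_top _ _) ((G.surfaceGluing ρ).edist_le_of_piece hz hw)

theorem spineSide_subset_piece (x : X) : G.spineSide ρ x ⊆ G.piece ρ x :=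
  fun z hz => ⟨z, hz, Hyp.right_mem_seg _ _⟩

theorem surfacePoint_s₁ (x : X) {z w : ℍ} (hz : z ∈ G.spineSide ρ x)
    (hw : w ∈ G.spineSide ρ (G.s₁ x))
    (h : dist z (G.tailCorner ρ x) = dist w (G.headCorner ρ (G.s₁ x))) :
    G.surfacePoint ρ x (G.spineSide_subset_piece x hz) =
      G.surfacePoint ρ (G.s₁ x) (G.spineSide_subset_piece _ hw) :=
  (G.surfaceGluing ρ).toSpace_eq_of_glue (Or.inl ⟨rfl, hz, hw, h⟩)

variable (ρ) in
theorem surfacePoint_headCorner_s₂ (x : X) :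
    G.surfacePoint ρ x (G.headCorner_mem_piece ρ x) =
      G.surfacePoint ρ (G.s₂ x) (G.tailCorner_mem_piece ρ _) :=
  (G.surfaceGluing ρ).toSpace_eq_of_glue (Or.inr ⟨rfl, Hyp.right_mem_seg _ _,
    Hyp.right_mem_seg _ _, (dist_self _).trans (dist_self _).symm⟩)

variable (ρ) in
theorem surfacePoint_headCorner_s₀ (x : X) :
    G.surfacePoint ρ (G.s₀ x) (G.headCorner_mem_piece ρ _) =
      G.surfacePoint ρ x (G.headCorner_mem_piece ρ x) := by
  have hs₂ : G.s₂ (G.s₀ x) = G.s₁ x := by simp [RibbonGraph.s₂]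
  have hs₁ := G.surfacePoint_s₁ (ρ := ρ) (G.s₁ x) (Hyp.left_mem_seg _ _) (Hyp.right_mem_seg _ _)
    ((dist_self _).trans (dist_self _).symm)
  rw [G.surfacePoint_headCorner_s₂]
  simp only [hs₂]
  refine hs₁.trans ?_
  simp only [G.s₁_s₁]

variable (ρ) in
theorem surfacePoint_headCorner_eq {x y : X} (h : G.head x = G.head y) :
    G.surfacePoint ρ x (G.headCorner_mem_piece ρ x) =
      G.surfacePoint ρ y (G.headCorner_mem_piece ρ y) :=
  eq_of_sameCycle (f := fun x => G.surfacePoint ρ x (G.headCorner_mem_piece ρ x))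
    (G.surfacePoint_headCorner_s₀ ρ) (Quotient.exact h)

theorem proj_mem_Icc (hρ : ∀ v, 0 ≤ ρ v) {x : X} {z : ℍ} (hz : z ∈ G.piece ρ x) :
    Hyp.proj z ∈ Set.Icc 0 (G.len x) := by
  obtain ⟨y, hy, hzy, -⟩ := Hyp.exists_mem_side_of_mem_quad
    ⟨hρ _, le_max_left _ _⟩ ⟨hρ _, le_max_right _ _⟩ hz
  exact hzy ▸ Hyp.proj_mem_Icc_of_mem_side (G.len_pos x).le hy

theorem exists_lipschitzWith_proj (hρ : ∀ v, 0 ≤ ρ v) :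
    ∃ φ : G.GluedSurface ρ → G.Graph, LipschitzWith 1 φ ∧ ∀ (x : X) {z : ℍ} (hz : z ∈ G.piece ρ x),
      φ (G.surfacePoint ρ x hz) = G.graphPoint x (G.proj_mem_Icc hρ hz) := by
  suffices h : ∃ φ : G.GluedSurface ρ → G.Graph, LipschitzWith 1 φ ∧
      ∀ p, φ ((G.surfaceGluing ρ).toSpace p) = G.graphPoint p.idx (G.proj_mem_Icc hρ p.mem) by
    obtain ⟨φ, hφ, heq⟩ := h
    exact ⟨φ, hφ, fun x z hz => heq ⟨x, z, hz⟩⟩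
  refine (G.surfaceGluing ρ).exists_lipschitzWith_lift one_ne_zero ?_ ?_
  · rintro ⟨x, z, hz⟩ ⟨y, w, hw⟩ (⟨rfl, hzx, hwy, hdist⟩ | ⟨rfl, hzx, hwy, -⟩)
    · refine G.graphPoint_s₁ x _ _ ?_
      dsimp only at hzx hwy hdist
      rw [spineSide, tailCorner, headCorner, G.tail_s₁, G.len_s₁] at hwy
      rw [tailCorner, headCorner, G.len_s₁] at hdist
      exact Hyp.proj_add_proj_of_mem_side hzx hwy hdist
    · refine G.graphPoint_head_eq_tail (G.tail_s₂ x).symm _ _ ?_ ?_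
      · exact (Hyp.proj_eq_of_mem_seg ((Hyp.proj_fermi _ _).trans (Hyp.proj_fermi _ _).symm)
          hzx).trans (Hyp.proj_fermi _ _)
      · exact (Hyp.proj_eq_of_mem_seg ((Hyp.proj_fermi _ _).trans (Hyp.proj_fermi _ _).symm)
          hwy).trans (Hyp.proj_fermi _ _)
  · rintro ⟨x, z, hz⟩ ⟨_, w, hw⟩ rfl
    rw [ENNReal.coe_one, one_mul, edist_dist, edist_dist]
    exact ENNReal.ofReal_le_ofReal
      ((G.dist_graphPoint_le x _ _).trans (Hyp.abs_proj_sub_le_dist z w))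

/-- The point of the spine at the position `a` of the edge `x`, where edges of the graph are mapped
affinely to edges of the spine. -/
def spinePoint (ρ : G.Vertex → ℝ) (x : X) (a : ℝ) : ℍ :=
  Hyp.sidePoint (G.len x) (ρ (G.tail x)) (ρ (G.head x)) a

theorem spinePoint_mem_spineSide (x : X) {a : ℝ} (ha : a ∈ Set.Icc 0 (G.len x)) :
    G.spinePoint ρ x a ∈ G.spineSide ρ x := Hyp.sidePoint_mem_side _ _ ha

theorem surfacePoint_spinePoint_s₁ (x : X) {a b : ℝ} (ha : a ∈ Set.Icc 0 (G.len x))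
    (hb : b ∈ Set.Icc 0 (G.len (G.s₁ x))) (h : a + b = G.len x) :
    G.surfacePoint ρ x (G.spineSide_subset_piece x (G.spinePoint_mem_spineSide x ha)) =
      G.surfacePoint ρ (G.s₁ x)
        (G.spineSide_subset_piece _ (G.spinePoint_mem_spineSide _ hb)) := by
  refine G.surfacePoint_s₁ x (G.spinePoint_mem_spineSide x ha)
    (G.spinePoint_mem_spineSide _ hb) ?_
  have hl := (G.len_pos x).ne'
  rw [dist_comm, spinePoint, spinePoint, tailCorner, headCorner, Hyp.dist_left_sidePoint _ _ ha,
    Hyp.dist_sidePoint_right _ _ hb, G.len_s₁, G.tail_s₁, RibbonGraph.tail,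
    Hyp.dist_corners_comm _ (ρ (G.head x)), eq_sub_of_add_eq h]
  field_simp

theorem exists_lipschitzWith_spine {m R : ℝ} (hm : 0 < m) (hlen : ∀ x, m ≤ G.len x) (hR : 0 ≤ R)
    (hρ : ∀ v, ρ v ∈ Set.Icc 0 R) :
    ∃ ψ : G.Graph → G.GluedSurface ρ, LipschitzWith (1 + 2 * R / m).toNNReal ψ ∧
      ∀ (x : X) {a : ℝ} (ha : a ∈ Set.Icc 0 (G.len x)), ψ (G.graphPoint x ha) =
        G.surfacePoint ρ x (G.spineSide_subset_piece x (G.spinePoint_mem_spineSide x ha)) := by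
  have hK : 0 < 1 + 2 * R / m := by positivity
  suffices h : ∃ ψ : G.Graph → G.GluedSurface ρ, LipschitzWith (1 + 2 * R / m).toNNReal ψ ∧
      ∀ p, ψ (G.graphGluing.toSpace p) = G.surfacePoint ρ p.idx
        (G.spineSide_subset_piece _ (G.spinePoint_mem_spineSide p.idx p.mem)) by
    obtain ⟨ψ, hψ, heq⟩ := h
    exact ⟨ψ, hψ, fun x a ha => heq ⟨x, a, ha⟩⟩
  refine G.graphGluing.exists_lipschitzWith_lift (Real.toNNReal_pos.2 hK).ne' ?_ ?_
  · rintro ⟨x, a, ha⟩ ⟨y, b, hb⟩ (⟨rfl, hab⟩ | ⟨hxy, ha₁, hb₁⟩)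
    · exact G.surfacePoint_spinePoint_s₁ x ha hb hab
    · dsimp only at ha₁ hb₁
      subst ha₁ hb₁
      simp only [spinePoint, Hyp.sidePoint_right (G.len_pos _).ne']
      exact G.surfacePoint_headCorner_eq ρ hxy
  · rintro ⟨x, a, ha⟩ ⟨_, b, hb⟩ rfl
    have hl := G.len_pos x
    have hstretch : dist (Hyp.fermi 0 (ρ (G.tail x))) (Hyp.fermi (G.len x) (ρ (G.head x))) /
        G.len x ≤ 1 + 2 * R / m :=
      calc _ ≤ (G.len x + 2 * R) / G.len x := by
            gcongr
            exact (Hyp.dist_corners_mem_Icc hl.le (hρ _) (hρ _)).2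
        _ = 1 + 2 * R / G.len x := by field_simp
        _ ≤ 1 + 2 * R / m := by
            gcongr
            exact hlen x
    rw [edist_dist, edist_dist, ENNReal.ofNNReal_toNNReal, ← ENNReal.ofReal_mul hK.le]
    refine ENNReal.ofReal_le_ofReal ((G.dist_surfacePoint_le x _ _).trans ?_)
    rw [spinePoint, spinePoint, Hyp.dist_sidePoint _ _ ha hb, Real.dist_eq]
    exact mul_le_mul_of_nonneg_right hstretch (abs_nonneg _)

theorem exists_lipschitz_approx_inverse {m R : ℝ} (hm : 0 < m) (hlen : ∀ x, m ≤ G.len x)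
    (hR : 0 ≤ R) (hρ : ∀ v, ρ v ∈ Set.Icc 0 R) :
    ∃ (φ : G.GluedSurface ρ → G.Graph) (ψ : G.Graph → G.GluedSurface ρ), LipschitzWith 1 φ ∧
      LipschitzWith (1 + 2 * R / m).toNNReal ψ ∧ (∀ u, dist (ψ (φ u)) u ≤ 3 * R) ∧
      ∀ g, dist (φ (ψ g)) g ≤ 2 * R := by
  obtain ⟨φ, hφ, hφ_eq⟩ := G.exists_lipschitzWith_proj fun v => (hρ v).1
  obtain ⟨ψ, hψ, hψ_eq⟩ := G.exists_lipschitzWith_spine hm hlen hR hρ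
  refine ⟨φ, ψ, hφ, hψ, fun u => ?_, fun g => ?_⟩
  · obtain ⟨x, z, hz, rfl⟩ := G.exists_surfacePoint_eq u
    rw [hφ_eq, hψ_eq]
    exact (G.dist_surfacePoint_le x _ _).trans
      (Hyp.dist_sidePoint_proj_le (G.len_pos x).le (hρ _) (hρ _) hz)
  · obtain ⟨x, a, ha, rfl⟩ := G.exists_graphPoint_eq g
    rw [hψ_eq, hφ_eq]
    exact (G.dist_graphPoint_le x _ _).trans (Hyp.abs_proj_sidePoint_sub_le (hρ _) (hρ _) ha)

end MetricRibbonGraph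

/-! ## Gromov–Hausdorff distance -/

theorem abs_mul_dist_sub_dist_le {Y Z : Type*} [MetricSpace Y] [MetricSpace Z] [CompactSpace Z]
    {f : Y → Z} {g : Z → Y} {c η ε : ℝ} (hc : 0 ≤ c) (hη : 0 ≤ η)
    (hf : ∀ u v, dist (f u) (f v) ≤ c * dist u v)
    (hg : ∀ a b, c * dist (g a) (g b) ≤ (1 + η) * dist a b) (hgf : ∀ u, dist (g (f u)) u ≤ ε)
    (u v : Y) :
    |c * dist u v - dist (f u) (f v)| ≤ η * Metric.diam (Set.univ : Set Z) + 2 * (c * ε) := by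
  have hdiam : η * dist (f u) (f v) ≤ η * Metric.diam (Set.univ : Set Z) := by
    gcongr
    exact Metric.dist_le_diam_of_mem isCompact_univ.isBounded trivial trivial
  have hε : 0 ≤ c * ε := mul_nonneg hc (dist_nonneg.trans (hgf u))
  have hD : 0 ≤ η * dist (f u) (f v) := mul_nonneg hη dist_nonneg
  have hupper : c * dist u v ≤ (1 + η) * dist (f u) (f v) + 2 * (c * ε) :=
    calc c * dist u v ≤ c * (dist (g (f u)) u + dist (g (f u)) (g (f v)) + dist (g (f v)) v) := by
          gcongr
          rw [dist_comm (g (f u)) u]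
          exact dist_triangle4 _ _ _ _
      _ = c * dist (g (f u)) (g (f v)) + (c * dist (g (f u)) u + c * dist (g (f v)) v) := by ring
      _ ≤ (1 + η) * dist (f u) (f v) + (c * ε + c * ε) :=
          add_le_add (hg _ _) (add_le_add (mul_le_mul_of_nonneg_left (hgf u) hc)
            (mul_le_mul_of_nonneg_left (hgf v) hc))
      _ = _ := by ring
  rw [abs_le]
  constructor <;> linarith [hf u v]

theorem ghDist_rescaled_le {Y Z : Type*} [MetricSpace Y] [CompactSpace Y] [Nonempty Y]
    [MetricSpace Z] [CompactSpace Z] [Nonempty Z] {f : Y → Z} {g : Z → Y} (c : PosReal)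
    {η ε δ : ℝ} (hη : 0 ≤ η) (hf : ∀ u v, dist (f u) (f v) ≤ c * dist u v)
    (hg : ∀ a b, c * dist (g a) (g b) ≤ (1 + η) * dist a b) (hgf : ∀ u, dist (g (f u)) u ≤ ε)
    (hfg : ∀ z, dist (f (g z)) z ≤ δ) :
    GromovHausdorff.ghDist (Rescaled c Y) Z ≤
      (η * Metric.diam (Set.univ : Set Z) + 2 * (c * ε)) / 2 + δ := by
  rw [← zero_add (_ / 2)]
  exact GromovHausdorff.ghDist_le_of_approx_subsets (s := Set.univ) (fun u => f u.1.val)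
    (fun u => ⟨u, trivial, (dist_self u).le⟩)
    (fun z => ⟨⟨⟨g z⟩, trivial⟩, (dist_comm _ _).trans_le (hfg z)⟩)
    fun u v => abs_mul_dist_sub_dist_le c.2.le hη hf hg hgf u.1.val v.1.val

namespace MetricRibbonGraph

variable {X : Type*} {n : ℕ}

theorem mul_mem_Icc_len {G H : MetricRibbonGraph X n} {c : NNReal}
    (hlen : ∀ x, H.len x = c * G.len x) {x : X} {a : ℝ} (ha : a ∈ Set.Icc 0 (G.len x)) :
    c * a ∈ Set.Icc 0 (H.len x) :=
  ⟨mul_nonneg c.coe_nonneg ha.1,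
    (mul_le_mul_of_nonneg_left ha.2 c.coe_nonneg).trans_eq (hlen x).symm⟩

theorem exists_lipschitzWith_of_len_eq {G H : MetricRibbonGraph X n}
    (h : H.toRibbonGraph = G.toRibbonGraph) {c : NNReal} (hc : c ≠ 0)
    (hlen : ∀ x, H.len x = c * G.len x) :
    ∃ τ : G.Graph → H.Graph, LipschitzWith c τ ∧ ∀ (x : X) {a : ℝ} (ha : a ∈ Set.Icc 0 (G.len x)),
      τ (G.graphPoint x ha) = H.graphPoint x (mul_mem_Icc_len hlen ha) := by
  suffices hτ : ∃ τ : G.Graph → H.Graph, LipschitzWith c τ ∧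
      ∀ p, τ (G.graphGluing.toSpace p) = H.graphPoint p.idx (mul_mem_Icc_len hlen p.mem) by
    obtain ⟨τ, hτ, heq⟩ := hτ
    exact ⟨τ, hτ, fun x a ha => heq ⟨x, a, ha⟩⟩
  refine G.graphGluing.exists_lipschitzWith_lift hc ?_ ?_
  · rintro ⟨x, a, ha⟩ ⟨y, b, hb⟩ hglue
    refine H.graphGluing.toSpace_eq_of_glue ?_
    have hs₁ : H.s₁ = G.s₁ := by rw [h]
    have hhead : H.head x = H.head y ↔ G.head x = G.head y := by rw [h]
    rcases hglue with ⟨rfl, hab⟩ | ⟨hxy, ha₁, hb₁⟩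
    · exact Or.inl ⟨congrArg (· x) hs₁.symm, by rw [hlen, ← mul_add]; exact congrArg _ hab⟩
    · exact Or.inr ⟨hhead.2 hxy, by rw [hlen]; exact congrArg _ ha₁,
        by rw [hlen]; exact congrArg _ hb₁⟩
  · rintro ⟨x, a, ha⟩ ⟨_, b, hb⟩ rfl
    change edist (H.graphPoint x (mul_mem_Icc_len hlen ha))
      (H.graphPoint x (mul_mem_Icc_len hlen hb)) ≤ c * edist a b
    rw [edist_dist, edist_dist, ← ENNReal.ofReal_coe_nnreal, ← ENNReal.ofReal_mul c.coe_nonneg]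
    refine ENNReal.ofReal_le_ofReal ((H.dist_graphPoint_le x _ _).trans_eq ?_)
    rw [← mul_sub, abs_mul, abs_of_nonneg c.coe_nonneg, Real.dist_eq]

variable (G : MetricRibbonGraph X n)

theorem exists_equiv_scale_dist_eq (N : PosReal) :
    ∃ e : G.Graph ≃ (G.scale N).Graph, ∀ p q, dist (e p) (e q) = N * dist p q := by
  set c : NNReal := ⟨N, N.2.le⟩
  have hc : 0 < c := N.2
  have hc' : (c : ℝ) ≠ 0 := N.2.ne'
  have hlen : ∀ x, (G.scale N).len x = c * G.len x := fun _ => rfl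
  obtain ⟨τ, hτ, hτ_eq⟩ := exists_lipschitzWith_of_len_eq (G := G) (H := G.scale N) rfl hc.ne' hlen
  obtain ⟨σ, hσ, hσ_eq⟩ := exists_lipschitzWith_of_len_eq (G := G.scale N) (H := G) rfl
    (inv_pos.2 hc).ne' fun x => by
      rw [hlen, NNReal.coe_inv, inv_mul_cancel_left₀ hc']
  have hστ : Function.LeftInverse σ τ := fun p => by
    obtain ⟨x, a, ha, rfl⟩ := G.exists_graphPoint_eq p
    simp only [hτ_eq, hσ_eq, NNReal.coe_inv, inv_mul_cancel_left₀ hc']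
  have hτσ : Function.RightInverse σ τ := fun p => by
    obtain ⟨x, a, ha, rfl⟩ := (G.scale N).exists_graphPoint_eq p
    simp only [hτ_eq, hσ_eq, NNReal.coe_inv, mul_inv_cancel_left₀ hc']
  refine ⟨⟨τ, σ, hστ, hτσ⟩, fun p q => le_antisymm (hτ.dist_le_mul p q) ?_⟩
  have h := hσ.dist_le_mul (τ p) (τ q)
  rw [hστ, hστ] at h
  exact (le_inv_mul_iff₀ N.2).1 h

theorem ghDist_rescaled_scale_le [Finite X] [Nonempty X] (N : PosReal) {m R : ℝ} (hm : 0 < m)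
    (hlen : ∀ x, m ≤ G.len x) {ρ : (G.scale N).Vertex → ℝ} (hρ : ∀ v, ρ v ∈ Set.Icc 0 R) :
    GromovHausdorff.ghDist (Rescaled N⁻¹ ((G.scale N).GluedSurface ρ)) G.Graph ≤
      (N : ℝ)⁻¹ * (R / m * Metric.diam (Set.univ : Set G.Graph) + 5 * R) := by
  have hN : (0 : ℝ) < N := N.2
  have hR : 0 ≤ R := by
    obtain ⟨hle, hge⟩ := hρ ((G.scale N).head (Classical.arbitrary X))
    exact hle.trans hge
  obtain ⟨φ, ψ, hφ, hψ, hψφ, hφψ⟩ := (G.scale N).exists_lipschitz_approx_inverse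
    (mul_pos hN hm) (fun x => mul_le_mul_of_nonneg_left (hlen x) hN.le) hR hρ
  obtain ⟨e, he⟩ := G.exists_equiv_scale_dist_eq N
  have he' : ∀ p q, dist (e.symm p) (e.symm q) = (N : ℝ)⁻¹ * dist p q := fun p q => by
    rw [eq_inv_mul_iff_mul_eq₀ hN.ne', ← he, e.apply_symm_apply, e.apply_symm_apply]
  have hη : 0 ≤ 2 * R / (N * m) := by positivity
  refine (ghDist_rescaled_le (f := e.symm ∘ φ) (g := ψ ∘ e) N⁻¹ (ε := 3 * R)
    (δ := (N : ℝ)⁻¹ * (2 * R)) hη (fun u v => ?_) (fun a b => ?_) (fun u => ?_)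
    fun z => ?_).trans_eq ?_
  · rw [Positive.coe_inv, Function.comp_apply, Function.comp_apply, he']
    gcongr
    simpa using hφ.dist_le_mul u v
  · have h := hψ.dist_le_mul (e a) (e b)
    rw [Real.coe_toNNReal _ (by positivity), he, mul_left_comm] at h
    rwa [Positive.coe_inv, inv_mul_le_iff₀ hN]
  · simpa using hψφ u
  · calc dist (e.symm (φ (ψ (e z)))) z = (N : ℝ)⁻¹ * dist (φ (ψ (e z))) (e z) := by
          rw [← he', e.symm_apply_apply]
      _ ≤ (N : ℝ)⁻¹ * (2 * R) := by
          gcongr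
          exact hφψ _
  · rw [Positive.coe_inv]
    field_simp
    ring

end MetricRibbonGraph

theorem tendsto_coe_posReal_atTop : Tendsto (fun N : PosReal => (N : ℝ)) atTop atTop :=
  tendsto_atTop.2 fun b => (eventually_ge_atTop (⟨max b 1, by positivity⟩ : PosReal)).mono
    fun _ hN => (le_max_left b 1).trans hN

end

theorem theorem5p6 {X : Type*} [Fintype X] [Nonempty X] {n : ℕ} (Γ : MetricRibbonGraph X n) :
    (∀ N : PosReal, ∃! ρ : (Γ.scale N).Vertex → ℝ, (Γ.scale N).IsRibLengths ρ) ∧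
    Tendsto
      (fun N : PosReal => GromovHausdorff.toGHSpace (Rescaled N⁻¹ (Γ.scale N).Surface))
      atTop (𝓝 (GromovHausdorff.toGHSpace Γ.Graph)) := by
  refine ⟨fun N => (Γ.scale N).existsUnique_isRibLengths, ?_⟩
  obtain ⟨x₀, hx₀⟩ := Finite.exists_min Γ.len
  have hm := Γ.len_pos x₀
  obtain ⟨R, hR⟩ := MetricRibbonGraph.exists_forall_ribLengths_mem_Icc X n hm
  set C := R / Γ.len x₀ * Metric.diam (Set.univ : Set Γ.Graph) + 5 * R
  have hlim : Tendsto (fun N : PosReal => (N : ℝ)⁻¹ * C) atTop (𝓝 0) := by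
    simpa using (tendsto_inv_atTop_zero.comp tendsto_coe_posReal_atTop).mul_const C
  rw [tendsto_iff_dist_tendsto_zero]
  refine squeeze_zero' (Eventually.of_forall fun _ => dist_nonneg) ?_ hlim
  filter_upwards [tendsto_coe_posReal_atTop.eventually_ge_atTop 1] with N hN
  have hlen : ∀ x, Γ.len x₀ ≤ (Γ.scale N).len x := fun x =>
    (hx₀ x).trans (le_mul_of_one_le_left (Γ.len_pos x).le hN)
  exact Γ.ghDist_rescaled_scale_le N hm hx₀ (hR (Γ.scale N) hlen)
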